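/- **Setting.** Let $\mathbf k$ be an algebraically closed field of characteristic $0$ and let $K^*/K$ be a finite extension of algebraic function fields of transcendence degree $2$ over $\mathbf k$. Let $\nu^*$ be a $\mathbf k$-valuation of $K^*$ with valuation ring $V^*$, whose value group is a subgroup of $\mathbb Q$ and with $V^*/m_{V^*}=\mathbf k$, and let $\nu=\nu^*|_K$. Let $R\subset K$ and $S\subset K^*$ be regular local rings, essentially of finite type over $\mathbf k$, with quotient fields $K$ and $K^*$, such that $V^*$ dominates $S$ and $S$ dominates $R$. **Quadratic transforms.** A quadratic transform of a local domain $A$ is a ring $A'=A[m_A/f]_P$ with $0\neq f\in m_A$ and $P$ a prime ideal of $A[m_A/f]$ such that $P\cap A=m_A$; it is along a valuation if the valuation dominates $A'$. **Jumping polynomials.** Let $\omega$ be a $\mathbb Q$-valued valuation dominating a ring $A$ that contains $\mathbf k$, with residue field $\mathbf k$, and let $(a,b)$ be a regular system of parameters of $A$. The sequence of jumping polynomials $\{T_i\}_{i\ge 0}$ in $A$ with $T_0=a$, $T_1=b$ is defined as follows. Write $\beta_i=\omega(T_i)/\omega(a)$, so $\beta_0=1$, and write $\beta_1=p_1/q_1$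 with coprime positive integers $p_1,q_1$. For $i\ge 1$, $$T_{i+1}=T_i^{q_i}-\lambda_i\prod_{j=0}^{i-1}T_j^{n_{i,j}},$$ where the $n_{i,j}$ are nonnegative integers with $n_{i,j}<q_j$ for $1\le j<i$ (and no bound on $n_{i,0}$) such that $q_i\beta_i=\sum_{j=0}^{i-1}n_{i,j}\beta_j$, where $\lambda_i\in\mathbf k$ is the residue of $T_i^{q_i}/\prod_{j=0}^{i-1}T_j^{n_{i,j}}$, and where the coprime positive integers $p_{i+1},q_{i+1}$ are defined by $$\beta_{i+1}=q_i\beta_i+\frac{1}{q_1\cdots q_i}\cdot\frac{p_{i+1}}{q_{i+1}}.$$ **Lemma 8.3.** Suppose that $R$ has regular parameters $(u,v)$ and $S$ has regular parameters $(x,y)$ such that $$u=x^t\delta,\qquad v=y,$$ where $t$ is a positive integer and $\delta$ is a unit of $S$. Let $\delta^{1/t}$ be a $t$-th root of $\delta$ in an extension field of $K^*$, extend $\nu^*$ to a $\mathbb Q$-valued valuation of $K^*(\delta^{1/t})$ (its residue field is again $\mathbf k$), and let $\tilde S$ be the localization of $S[\delta^{1/t}]$ at the centre of the extended valuation. Let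 $\{T_i\}_{i\ge 0}$ be the sequence of jumping polynomials in $\tilde S$ with $T_0=x\delta^{1/t}$ and $T_1=y$, and let $(p_i,q_i)$, $i\geq 1$, be the pairs of coprime positive integers that occur in its construction. Then at least one of the following holds. 1. The elements $T_i$, $i>0$, lie in $R$, and $u,T_1,T_2,\dots$ is the sequence of jumping polynomials in $R$, with respect to $\nu$, that starts with $u,v$. 2. The set $\{i>0 : t\nmid p_i\}$ is nonempty and, with $M$ its least element and $g=\gcd(t,p_M)$, we have $0<g<t$ and there are finite sequences of quadratic transforms $R\to R'$ and $S\to S'$ along $\nu^*$ such that $S'$ dominates $R'$, the ring $R'$ is regular with regular parameters $(U,V)$, the ring $S'$ is regular with regular parameters $(X,Y)$, and $$U=X^g\Delta,\qquad V=Y$$ for some unit $\Delta$ of $S'$. -/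

import Mathlib

namespace JumpingPoly

section Rings

variable {k F : Type*} [Field k] [Field F] [Algebra k F]

/-- The set of non-units of a subalgebra `A` of the field `F`, viewed inside `F`. If `A` is a local
ring, then this is its maximal ideal `m_A`. -/
def maxSet (A : Subalgebra k F) : Set F :=
  {a | ∃ h : a ∈ A, ¬ IsUnit (⟨a, h⟩ : A)}

/-- `A` is a two-dimensional regular local ring with regular system of parameters `(x, y)`. -/
def IsRegularParameters (A : Subalgebra k F) (x y : F) : Prop :=
  ∃ (_ : IsRegularLocalRing A) (hx : x ∈ A) (hy : y ∈ A),
    ringKrullDim A = 2 ∧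
    IsLocalRing.maximalIdeal A = Ideal.span {(⟨x, hx⟩ : A), (⟨y, hy⟩ : A)}

/-- The ring of fractions `M⁻¹B` inside the field `F`, where `B` is a subalgebra of `F` and `M` is
a multiplicative subset of `B`. -/
def fractions (B : Subalgebra k F) (M : Submonoid B) : Subalgebra k F where
  carrier := {z | ∃ a b : B, b ∈ M ∧ (b : F) ≠ 0 ∧ z = a / b}
  mul_mem' := by
    rintro _ _ ⟨a, b, hb, hb0, rfl⟩ ⟨c, d, hd, hd0, rfl⟩
    refine ⟨a * c, b * d, M.mul_mem hb hd, ?_, ?_⟩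
    · push_cast
      exact mul_ne_zero hb0 hd0
    · push_cast
      rw [div_mul_div_comm]
  add_mem' := by
    rintro _ _ ⟨a, b, hb, hb0, rfl⟩ ⟨c, d, hd, hd0, rfl⟩
    refine ⟨a * d + b * c, b * d, M.mul_mem hb hd, ?_, ?_⟩
    · push_cast
      exact mul_ne_zero hb0 hd0
    · push_cast
      rw [div_add_div _ _ hb0 hd0]
  algebraMap_mem' := by
    intro c
    refine ⟨algebraMap k B c, 1, M.one_mem, by simp, ?_⟩
    simp

/-- The ring `A[m_A / x]`, as a subalgebra of `F`. -/
def chart (A : Subalgebra k F) (x : F) : Subalgebra k F :=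
  Algebra.adjoin k ((A : Set F) ∪ {z | ∃ a ∈ maxSet A, z = a / x})

/-- `A → A'` is a quadratic transform of the local ring `A`: one has `A' = A[m_A / x]_P` for some
`0 ≠ x ∈ m_A` and some prime ideal `P` of `A[m_A / x]` with `P ∩ A = m_A`. -/
def IsQuadraticTransform (A A' : Subalgebra k F) : Prop :=
  IsLocalRing A ∧ ∃ x ∈ maxSet A, x ≠ 0 ∧
    ∃ (P : Ideal (chart A x)) (_ : P.IsPrime),
      (∀ b : chart A x, (b : F) ∈ A → (b ∈ P ↔ (b : F) ∈ maxSet A)) ∧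
      A' = fractions (chart A x) P.primeCompl

/-- The valuation ring `V = {ν ≥ 0}` dominates `A`: one has `A ⊆ V` and `m_V ∩ A` is the set of
non-units of `A`. -/
def Dominates (ν : AddValuation F (WithTop ℚ)) (A : Subalgebra k F) : Prop :=
  ∀ a ∈ A, 0 ≤ ν a ∧ (0 < ν a ↔ a ∈ maxSet A)

/-- `A'` is obtained from `A` by a finite sequence of quadratic transforms along `ν`, i.e. `ν`
dominates each of the rings that occur. -/
def QuadraticSequence (ν : AddValuation F (WithTop ℚ)) (A A' : Subalgebra k F) : Prop :=
  Relation.ReflTransGen (fun B B' => IsQuadraticTransform B B' ∧ Dominates ν B') A A'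

/-- The localization of `B` at the centre `{b ∈ B | ν b > 0}` of `ν`, for a subalgebra `B` of the
valuation ring of `ν`; on such a `B` the complement of the centre is `{b ∈ B | ν b = 0}`. -/
def localizeAtCentre (ν : AddValuation F (WithTop ℚ)) (B : Subalgebra k F) : Subalgebra k F :=
  fractions B
    { carrier := {b | ν (b : F) = 0}
      one_mem' := by simp
      mul_mem' := by
        intro a b ha hb
        change ν (a : F) = 0 at ha
        change ν (b : F) = 0 at hb
        change ν ((a : F) * (b : F)) = 0
        rw [AddValuation.map_mul, ha, hb, add_zero] }

open scoped BigOperators in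
/-- `T 0, T 1, T 2, …` is the sequence of jumping polynomials in `A` with respect to `ν` that starts
with the pair `(T 0, T 1)` of parameters of `A`, and `(p i, q i)`, `i ≥ 1`, are the pairs of coprime
positive integers that occur in its construction.

Here `μ = ν (T 0)`, and `β i = ν (T i) / ν (T 0)` is the value of `T i` after the normalization
which gives `T 0` the value `1`. There is no upper bound on `n i 0`. The condition on `lam i` says
that it is the residue of `T_i ^ q_i / ∏_{j < i} T_j ^ n_{i,j}`. -/
def IsJumpingSequence (ν : AddValuation F (WithTop ℚ)) (A : Subalgebra k F)
    (T : ℕ → F) (p q : ℕ → ℕ) : Prop :=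
  (∀ i, T i ∈ A) ∧
  ∃ (μ : ℚ) (β : ℕ → ℚ) (n : ℕ → ℕ → ℕ) (lam : ℕ → k),
    0 < μ ∧
    (∀ i, ν (T i) = ((μ * β i : ℚ) : WithTop ℚ)) ∧
    β 0 = 1 ∧
    β 1 = (p 1 : ℚ) / (q 1 : ℚ) ∧
    ∀ i, 1 ≤ i →
      0 < p i ∧ 0 < q i ∧ Nat.Coprime (p i) (q i) ∧
      (∀ j, 1 ≤ j → j < i → n i j < q j) ∧
      (q i : ℚ) * β i = ∑ j ∈ Finset.range i, (n i j : ℚ) * β j ∧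
      0 < ν (T i ^ q i / (∏ j ∈ Finset.range i, T j ^ n i j) - algebraMap k F (lam i)) ∧
      T (i + 1) =
        T i ^ q i - algebraMap k F (lam i) * ∏ j ∈ Finset.range i, T j ^ n i j ∧
      β (i + 1) = (q i : ℚ) * β i
        + 1 / (∏ j ∈ Finset.Icc 1 i, (q j : ℚ)) * ((p (i + 1) : ℚ) / (q (i + 1) : ℚ))

end Rings

section Extensions

variable {k K L : Type*} [Field k] [Field K] [Field L]
  [Algebra k K] [Algebra k L] [Algebra K L] [IsScalarTower k K L]

/-- The local ring `S ⊆ L` dominates the local ring `R ⊆ K`, where `L` is an extension field of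
`K`: one has `R ⊆ S` and `m_S ∩ R = m_R`. -/
def LocalDominates (R : Subalgebra k K) (S : Subalgebra k L) : Prop :=
  ∀ a ∈ R, algebraMap K L a ∈ S ∧ (algebraMap K L a ∈ maxSet S ↔ a ∈ maxSet R)

/-- The subring `S[ε]` of `L`, for a subalgebra `S` of the subfield `K` of `L` and `ε ∈ L`. -/
def adjoinElement (S : Subalgebra k K) (ε : L) : Subalgebra k L :=
  Algebra.adjoin k (algebraMap K L '' (S : Set K) ∪ {ε})

end Extensions

end JumpingPoly

/-! Let μ = ν(x), P_j = ∏_{i<j} T_i^{n_{j,i}} for j ≥ 1 and P_0 = 1, and put W_j = T_{j+1}/P_j. Thus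
W_0 = v, and W_j = T_j^{q_j}/P_j - λ_j for j ≥ 1. The recursion for β says that W_j has value
(μ/(q_1⋯q_j))·(p_{j+1}/q_{j+1}). This makes W_j the natural second parameter after j rounds of
blowing up in S, the first parameter then having value μ/(q_1⋯q_j).

As long as t divides p_1, …, p_i, it divides n_{i,0} (`dvd_exponent`). Since T_0^t = u, the
recursion for T_{i+1} then only involves elements of R (`exists_descent`). If t divides every p_i,
the whole sequence descends, with p_i replaced by p_i/t (`descend`).

Otherwise let M be the first failure. For j < M both rings are blown up by Euclid's algorithm,
upstairs for W_{j-1}^{q_j}/X^{p_j} and downstairs for W_{j-1}^{q_j}/U^{p_j/t}. This preserves the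
relation U = X^t·unit, and W_j becomes the second parameter of both rings
(`exists_toricPair_tower`). At M write t = t'g and p_M = p'g. Downstairs the relevant ratio is now
W_{M-1}^{t'q_M}/U^{p'}, which is, up to a unit, the t'-th power of the ratio W_{M-1}^{q_M}/X^{p_M}
upstairs. In characteristic 0 the map z ↦ z^{t'} is étale at a nonzero residue, so this power minus
its residue is still a second parameter upstairs (`pow_mul_sub`). The new first parameters satisfy
U' = X'^g·unit. Both kinds of step are instances of `IsToricPair.exists_transform`. -/

namespace JumpingPoly

/-! ### Rings of fractions inside the field. -/

section Fractions

variable {k F : Type*} [Field k] [Field F] [Algebra k F]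

theorem le_fractions (B : Subalgebra k F) (M : Submonoid B) : B ≤ fractions B M := fun b hb =>
  ⟨⟨b, hb⟩, 1, M.one_mem, by simp, by simp⟩

theorem isLocalization_fractions (B : Subalgebra k F) (M : Submonoid B) (hM : (0 : B) ∉ M) :
    letI := (Subalgebra.inclusion (le_fractions B M)).toRingHom.toAlgebra
    IsLocalization M (fractions B M) := by
  let := (Subalgebra.inclusion (le_fractions B M)).toRingHom.toAlgebra
  have hne : ∀ b : B, b ∈ M → (b : F) ≠ 0 := fun b hb h0 => hM (by
    have : b = 0 := Subtype.ext h0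
    rwa [this] at hb)
  have hval : ∀ b : B, ((algebraMap B (fractions B M) b : fractions B M) : F) = b := fun b => rfl
  refine (isLocalization_iff _ _).2 ⟨?_, ?_, ?_⟩
  · rintro ⟨b, hb⟩
    refine IsUnit.of_mul_eq_one (⟨(b : F)⁻¹, 1, b, hb, hne b hb, by simp⟩ : fractions B M) ?_
    apply Subtype.ext
    change (b : F) * (b : F)⁻¹ = 1
    exact mul_inv_cancel₀ (hne b hb)
  · rintro ⟨z, a, b, hb, hb0, rfl⟩
    refine ⟨(a, ⟨b, hb⟩), Subtype.ext ?_⟩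
    change (a : F) / b * b = a
    exact div_mul_cancel₀ _ hb0
  · intro x y h
    refine ⟨1, ?_⟩
    have : (x : F) = y := by rw [← hval, ← hval, h]
    rw [Subtype.ext this]

theorem isNoetherianRing_fractions (B : Subalgebra k F) (M : Submonoid B) (hM : (0 : B) ∉ M)
    [IsNoetherianRing B] : IsNoetherianRing (fractions B M) := by
  let := (Subalgebra.inclusion (le_fractions B M)).toRingHom.toAlgebra
  have := isLocalization_fractions B M hM
  exact IsLocalization.isNoetherianRing M _ inferInstance

theorem mem_maxSet_iff_inv_notMem {A : Subalgebra k F} {a : F} (ha : a ∈ A) :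
    a ∈ maxSet A ↔ a = 0 ∨ a⁻¹ ∉ A := by
  constructor
  · rintro ⟨h, hu⟩
    by_contra! hc
    refine hu (IsUnit.of_mul_eq_one (⟨a⁻¹, hc.2⟩ : A) (Subtype.ext ?_))
    exact mul_inv_cancel₀ hc.1
  · intro h
    refine ⟨ha, fun hu => ?_⟩
    obtain ⟨b, hb⟩ := hu.exists_right_inv
    have hb' : a * (b : F) = 1 := congrArg Subtype.val hb
    rcases h with rfl | h
    · simp at hb'
    · exact h (by rw [← eq_inv_of_mul_eq_one_right hb']; exact b.2)

end Fractions

/-! ### Arithmetic of rational values. -/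

section Valuation

variable {F : Type*} [Field F] (ν : AddValuation F (WithTop ℚ))

theorem exists_val_eq {f : F} (hf : f ≠ 0) : ∃ r : ℚ, ν f = r := by
  obtain ⟨r, hr⟩ := WithTop.ne_top_iff_exists.1 ((ν.ne_top_iff).2 hf)
  exact ⟨r, hr.symm⟩

variable {ν}

theorem ne_zero_of_val_eq {f : F} {r : ℚ} (h : ν f = r) : f ≠ 0 :=
  ν.ne_top_iff.1 (by rw [h]; exact WithTop.coe_ne_top)

theorem val_mul_eq {f g : F} {r s : ℚ} (hf : ν f = r) (hg : ν g = s) :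
    ν (f * g) = ((r + s : ℚ) : WithTop ℚ) := by
  rw [ν.map_mul, hf, hg, WithTop.coe_add]

theorem val_inv_eq {f : F} {r : ℚ} (hf : ν f = r) : ν f⁻¹ = ((-r : ℚ) : WithTop ℚ) := by
  rw [ν.map_inv, hf]; rfl

theorem val_div_eq {f g : F} {r s : ℚ} (hf : ν f = r) (hg : ν g = s) :
    ν (f / g) = ((r - s : ℚ) : WithTop ℚ) := by
  rw [div_eq_mul_inv, sub_eq_add_neg]
  exact val_mul_eq hf (val_inv_eq hg)

theorem val_pow_eq {f : F} {r : ℚ} (hf : ν f = r) (n : ℕ) :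
    ν (f ^ n) = ((n * r : ℚ) : WithTop ℚ) := by
  induction n with
  | zero => simp
  | succ n ih =>
    rw [pow_succ, val_mul_eq ih hf]
    exact congrArg _ (by push_cast; ring)

theorem val_zpow_eq {f : F} {r : ℚ} (hf : ν f = r) (n : ℤ) :
    ν (f ^ n) = ((n * r : ℚ) : WithTop ℚ) := by
  obtain ⟨m, rfl | rfl⟩ := n.eq_nat_or_neg
  · rw [zpow_natCast, val_pow_eq hf]; simp
  · rw [zpow_neg, zpow_natCast, val_inv_eq (val_pow_eq hf m)]; simp

theorem val_prod_eq {ι : Type*} (s : Finset ι) {f : ι → F} {r : ι → ℚ} (h : ∀ i ∈ s, ν (f i) = r i) :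
    ν (∏ i ∈ s, f i) = ((∑ i ∈ s, r i : ℚ) : WithTop ℚ) := by
  classical
  induction s using Finset.induction_on with
  | empty => simp
  | insert a s ha ih =>
    rw [Finset.prod_insert ha, Finset.sum_insert ha]
    exact val_mul_eq (h a (by simp)) (ih fun i hi => h i (by simp [hi]))

theorem ne_zero_of_val_eq_zero {f : F} (h : ν f = 0) : f ≠ 0 :=
  ne_zero_of_val_eq (r := 0) (by simpa using h)

theorem val_inv_eq_zero {f : F} (h : ν f = 0) : ν f⁻¹ = 0 := by
  have := val_inv_eq (ν := ν) (f := f) (r := 0) (by simpa using h)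
  simpa using this

end Valuation

/-! ### Local rings dominated by the valuation. -/

section Dominates

variable {k F : Type*} [Field k] [Field F] [Algebra k F] {ν : AddValuation F (WithTop ℚ)}
  {A : Subalgebra k F}

theorem Dominates.inv_mem (hA : Dominates ν A) {a : F} (ha : a ∈ A) (h : ν a = 0) : a⁻¹ ∈ A := by
  by_contra hc
  have := ((hA a ha).2).2 ((mem_maxSet_iff_inv_notMem ha).2 (Or.inr hc))
  exact this.ne' h

/-- An element of positive value has an inverse of negative value, which cannot lie in `A`; so only
elements of value zero need checking. -/
theorem dominates_of_inv_mem (h0 : ∀ a ∈ A, 0 ≤ ν a) (h1 : ∀ a ∈ A, ν a = 0 → a⁻¹ ∈ A) :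
    Dominates ν A := by
  refine fun a ha => ⟨h0 a ha, ?_⟩
  rw [mem_maxSet_iff_inv_notMem ha]
  constructor
  · intro hp
    by_contra! hc
    have h2 := h0 _ hc.2
    obtain ⟨r, hr⟩ := exists_val_eq ν hc.1
    rw [val_inv_eq hr] at h2
    rw [hr] at hp
    norm_cast at h2 hp
    linarith
  · rintro (rfl | h)
    · simp
    · exact lt_of_le_of_ne (h0 a ha) fun he => h (h1 a ha he.symm)

theorem Dominates.val_algebraMap_nonneg (hA : Dominates ν A) (c : k) : 0 ≤ ν (algebraMap k F c) :=
  (hA _ (A.algebraMap_mem c)).1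

theorem Dominates.val_algebraMap (hA : Dominates ν A) {c : k} (hc : c ≠ 0) :
    ν (algebraMap k F c) = 0 := by
  obtain ⟨r, hr⟩ := exists_val_eq ν ((map_ne_zero (algebraMap k F)).2 hc)
  have h1 := hA.val_algebraMap_nonneg c
  have h2 := hA.val_algebraMap_nonneg c⁻¹
  rw [map_inv₀, val_inv_eq hr] at h2
  rw [hr] at h1 ⊢
  norm_cast at h1 h2 ⊢
  linarith

theorem Dominates.isLocalRing (hA : Dominates ν A) : IsLocalRing A := by
  refine IsLocalRing.of_nonunits_add fun a b ha hb => ?_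
  have h1 := (hA a a.2).2.2 ⟨a.2, ha⟩
  have h2 := (hA b b.2).2.2 ⟨b.2, hb⟩
  obtain ⟨_, h⟩ := (hA _ (a + b).2).2.1 (ν.map_lt_add h1 h2)
  exact h

theorem Dominates.pos_iff_not_isUnit (hA : Dominates ν A) (a : A) :
    0 < ν (a : F) ↔ ¬ IsUnit a :=
  ((hA a a.2).2).trans ⟨fun ⟨_, h⟩ => h, fun h => ⟨a.2, h⟩⟩

theorem Dominates.mem_maximalIdeal_iff (hA : Dominates ν A) [IsLocalRing A] (a : A) :
    a ∈ IsLocalRing.maximalIdeal A ↔ 0 < ν (a : F) := by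
  rw [hA.pos_iff_not_isUnit, IsLocalRing.mem_maximalIdeal, mem_nonunits_iff]

theorem Dominates.comap {K : Type*} [Field K] [Algebra k K] [Algebra K F] {R : Subalgebra k K}
    (hA : Dominates ν A) (h : ∀ a ∈ R, algebraMap K F a ∈ A ∧
      (algebraMap K F a ∈ maxSet A ↔ a ∈ maxSet R)) :
    Dominates (ν.comap (algebraMap K F)) R := fun a ha =>
  ⟨(hA _ (h a ha).1).1, ((hA _ (h a ha).1).2).trans (h a ha).2⟩

end Dominates

/-! ### Localization at the centre. -/

section Centre

variable {k F : Type*} [Field k] [Field F] [Algebra k F] {ν : AddValuation F (WithTop ℚ)}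

/-- The centre of `ν` on a subalgebra of its valuation ring. -/
def centre (ν : AddValuation F (WithTop ℚ)) (B : Subalgebra k F) (hB : ∀ b ∈ B, 0 ≤ ν b) :
    Ideal B where
  carrier := {b | 0 < ν (b : F)}
  add_mem' := fun ha hb => ν.map_lt_add ha hb
  zero_mem' := by simp
  smul_mem' := fun c x hx => by
    change 0 < ν ((c : F) * (x : F))
    rw [ν.map_mul]
    exact lt_of_lt_of_le hx (le_add_of_nonneg_left (hB c c.2))

theorem centre_isPrime {B : Subalgebra k F} (hB : ∀ b ∈ B, 0 ≤ ν b) : (centre ν B hB).IsPrime := by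
  refine ⟨?_, fun {x y} h => ?_⟩
  · rw [Ideal.ne_top_iff_one]
    change ¬ (0 < ν ((1 : B) : F))
    simp
  · by_contra! hc
    have h1 : ν (x : F) = 0 := le_antisymm (not_lt.1 hc.1) (hB x x.2)
    have h2 : ν (y : F) = 0 := le_antisymm (not_lt.1 hc.2) (hB y y.2)
    change 0 < ν ((x : F) * (y : F)) at h
    rw [ν.map_mul, h1, h2] at h
    simp at h

theorem localizeAtCentre_eq {B : Subalgebra k F} (hB : ∀ b ∈ B, 0 ≤ ν b) :
    haveI := centre_isPrime hB
    localizeAtCentre ν B = fractions B (centre ν B hB).primeCompl := by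
  have := centre_isPrime hB
  unfold localizeAtCentre
  congr 1
  ext b
  change ν (b : F) = 0 ↔ ¬ (0 < ν (b : F))
  rw [not_lt]
  exact ⟨fun h => h.le, fun h => le_antisymm h (hB b b.2)⟩

theorem mem_localizeAtCentre {B : Subalgebra k F} {z : F} :
    z ∈ localizeAtCentre ν B ↔ ∃ a ∈ B, ∃ b ∈ B, ν b = 0 ∧ z = a / b := by
  constructor
  · rintro ⟨a, b, hb, _, rfl⟩
    exact ⟨a, a.2, b, b.2, hb, rfl⟩
  · rintro ⟨a, ha, b, hb, h, rfl⟩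
    exact ⟨⟨a, ha⟩, ⟨b, hb⟩, h, ne_zero_of_val_eq_zero h, rfl⟩

theorem le_localizeAtCentre (B : Subalgebra k F) : B ≤ localizeAtCentre ν B := le_fractions _ _

theorem val_div_of_val_eq_zero {a b : F} (h : ν b = 0) : ν (a / b) = ν a := by
  rw [div_eq_mul_inv, ν.map_mul, val_inv_eq_zero h, add_zero]

theorem dominates_localizeAtCentre {B : Subalgebra k F} (hB : ∀ b ∈ B, 0 ≤ ν b) :
    Dominates ν (localizeAtCentre ν B) := by
  refine dominates_of_inv_mem (fun z hz => ?_) (fun z hz h0 => ?_)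
  · obtain ⟨a, ha, b, hb, h, rfl⟩ := mem_localizeAtCentre.1 hz
    rw [val_div_of_val_eq_zero h]
    exact hB a ha
  · obtain ⟨a, ha, b, hb, h, rfl⟩ := mem_localizeAtCentre.1 hz
    rw [val_div_of_val_eq_zero h] at h0
    exact mem_localizeAtCentre.2 ⟨b, hb, a, ha, h0, inv_div _ _⟩

theorem localizeAtCentre_le {B C : Subalgebra k F} (hBC : B ≤ C)
    (hC : ∀ c ∈ C, ν c = 0 → c⁻¹ ∈ C) : localizeAtCentre ν B ≤ C := by
  intro z hz
  obtain ⟨a, ha, b, hb, h, rfl⟩ := mem_localizeAtCentre.1 hz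
  rw [div_eq_mul_inv]
  exact C.mul_mem (hBC ha) (hC b (hBC hb) h)

end Centre

/-! ### Regular parameters and the chart `A[b / a]`. -/

section QuadraticTransform

variable {k F : Type*} [Field k] [Field F] [Algebra k F] {ν : AddValuation F (WithTop ℚ)}
  {A : Subalgebra k F} {a b : F}

theorem IsRegularParameters.left_mem (h : IsRegularParameters A a b) : a ∈ A := h.2.1

theorem IsRegularParameters.right_mem (h : IsRegularParameters A a b) : b ∈ A := h.2.2.1

theorem IsRegularParameters.symm (h : IsRegularParameters A a b) : IsRegularParameters A b a := by
  obtain ⟨h1, h2, h3, h4, h5⟩ := h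
  exact ⟨h1, h3, h2, h4, by rw [h5, Set.pair_comm]⟩

theorem IsRegularParameters.mem_maxSet_iff (h : IsRegularParameters A a b) {f : F} :
    f ∈ maxSet A ↔ ∃ r ∈ A, ∃ s ∈ A, f = r * a + s * b := by
  obtain ⟨h1, h2, h3, h4, h5⟩ := h
  have key : ∀ g : A, ¬ IsUnit g ↔ ∃ r s : A, r * ⟨a, h2⟩ + s * ⟨b, h3⟩ = g := fun g => by
    rw [← mem_nonunits_iff, ← IsLocalRing.mem_maximalIdeal, h5, Ideal.mem_span_pair]
  constructor
  · rintro ⟨hf, hu⟩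
    obtain ⟨r, s, hrs⟩ := (key _).1 hu
    exact ⟨r, r.2, s, s.2, (congrArg Subtype.val hrs).symm⟩
  · rintro ⟨r, hr, s, hs, rfl⟩
    exact ⟨A.add_mem (A.mul_mem hr h2) (A.mul_mem hs h3), (key _).2 ⟨⟨r, hr⟩, ⟨s, hs⟩, rfl⟩⟩

theorem IsRegularParameters.left_mem_maxSet (h : IsRegularParameters A a b) : a ∈ maxSet A :=
  h.mem_maxSet_iff.2 ⟨1, A.one_mem, 0, A.zero_mem, by simp⟩

theorem IsRegularParameters.right_mem_maxSet (h : IsRegularParameters A a b) : b ∈ maxSet A :=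
  h.symm.left_mem_maxSet

theorem IsRegularParameters.val_left_pos (h : IsRegularParameters A a b) (hA : Dominates ν A) :
    0 < ν a := ((hA a h.left_mem).2).2 h.left_mem_maxSet

theorem IsRegularParameters.val_right_pos (h : IsRegularParameters A a b) (hA : Dominates ν A) :
    0 < ν b := h.symm.val_left_pos hA

theorem IsRegularParameters.exists_eq_add (h : IsRegularParameters A a b) (hA : Dominates ν A)
    {f : F} (hf : f ∈ A) (hν : 0 < ν f) : ∃ r ∈ A, ∃ s ∈ A, f = r * a + s * b :=
  h.mem_maxSet_iff.1 (((hA f hf).2).1 hν)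

/-- A prime ideal containing the second of two regular parameters and not the first one. -/
theorem IsRegularParameters.exists_prime (h : IsRegularParameters A a b) :
    ∃ Q : Ideal A, Q.IsPrime ∧ (⟨b, h.right_mem⟩ : A) ∈ Q ∧ (⟨a, h.left_mem⟩ : A) ∉ Q := by
  obtain ⟨h1, h2, h3, h4, h5⟩ := h
  have hne : Ideal.span {(⟨b, h3⟩ : A)} ≠ ⊤ := by
    intro ht
    have : Ideal.span {(⟨b, h3⟩ : A)} ≤ IsLocalRing.maximalIdeal A := by
      rw [h5]; exact Ideal.span_mono (by simp)
    rw [ht, top_le_iff] at this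
    exact (IsLocalRing.maximalIdeal.isMaximal A).ne_top this
  obtain ⟨Q, hQ⟩ := Ideal.nonempty_minimalPrimes hne
  have hQp : Q.IsPrime := hQ.1.1
  have hb : (⟨b, h3⟩ : A) ∈ Q := hQ.1.2 (Ideal.mem_span_singleton_self _)
  refine ⟨Q, hQp, hb, fun ha => ?_⟩
  have hm : IsLocalRing.maximalIdeal A ≤ Q := by
    rw [h5, Ideal.span_le]
    rintro z (rfl | rfl)
    · exact ha
    · exact hb
  have hQm : Q = IsLocalRing.maximalIdeal A :=
    le_antisymm (IsLocalRing.le_maximalIdeal hQp.ne_top) hm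
  -- Krull's principal ideal theorem: if `a` were in `Q`, then `Q` would be the maximal ideal, of
  -- height 2.
  have hle : Q.height ≤ 1 :=
    Ideal.height_le_one_of_isPrincipal_of_mem_minimalPrimes _ _ hQ
  have h6 := IsLocalRing.maximalIdeal_height_eq_ringKrullDim (R := A)
  rw [← hQm, h4] at h6
  have : (Q.height : WithBot ℕ∞) ≤ ((1 : ℕ∞) : WithBot ℕ∞) := by exact_mod_cast hle
  rw [h6] at this
  norm_cast at this

theorem IsRegularParameters.left_ne_zero (h : IsRegularParameters A a b) : a ≠ 0 := by
  rintro rfl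
  obtain ⟨Q, -, -, hQ⟩ := h.exists_prime
  exact hQ Q.zero_mem

theorem IsRegularParameters.right_ne_zero (h : IsRegularParameters A a b) : b ≠ 0 :=
  h.symm.left_ne_zero

/-- Replacing the second parameter by a combination of both with unit coefficient. -/
theorem IsRegularParameters.change_right (h : IsRegularParameters A a b) {s r : F} (hs : s ∈ A)
    (hs' : s⁻¹ ∈ A) (hs0 : s ≠ 0) (hr : r ∈ A) : IsRegularParameters A a (b * s + a * r) := by
  obtain ⟨h1, h2, h3, h4, h5⟩ := h
  refine ⟨h1, h2, A.add_mem (A.mul_mem h3 hs) (A.mul_mem h2 hr), h4, ?_⟩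
  rw [h5]
  apply le_antisymm
  · rw [Ideal.span_le]
    rintro z (rfl | rfl)
    · exact Ideal.subset_span (by simp)
    · refine Ideal.mem_span_pair.2 ⟨-⟨s⁻¹, hs'⟩ * ⟨r, hr⟩, ⟨s⁻¹, hs'⟩, Subtype.ext ?_⟩
      change -s⁻¹ * r * a + s⁻¹ * (b * s + a * r) = b
      field_simp
      ring
  · rw [Ideal.span_le]
    rintro z (rfl | rfl)
    · exact Ideal.subset_span (by simp)
    · refine Ideal.mem_span_pair.2 ⟨⟨r, hr⟩, ⟨s, hs⟩, Subtype.ext ?_⟩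
      change r * a + s * b = b * s + a * r
      ring

theorem le_chart (A : Subalgebra k F) (a : F) : A ≤ chart A a := fun _ h =>
  Algebra.subset_adjoin (Or.inl h)

theorem IsRegularParameters.div_mem_chart (h : IsRegularParameters A a b) : b / a ∈ chart A a :=
  Algebra.subset_adjoin (Or.inr ⟨b, h.right_mem_maxSet, rfl⟩)

/-- Since `a` and `b` generate the maximal ideal, adjoining `b / a` already gives the whole chart.
-/
theorem IsRegularParameters.chart_le (h : IsRegularParameters A a b) {B : Subalgebra k F}
    (hAB : A ≤ B) (hB : b / a ∈ B) : chart A a ≤ B := by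
  refine Algebra.adjoin_le ?_
  rintro z (hz | ⟨m, hm, rfl⟩)
  · exact hAB hz
  · obtain ⟨r, hr, s, hs, rfl⟩ := h.mem_maxSet_iff.1 hm
    have ha := h.left_ne_zero
    have : (r * a + s * b) / a = r + s * (b / a) := by field_simp
    change _ ∈ B
    rw [this]
    exact B.add_mem (hAB hr) (B.mul_mem (hAB hs) hB)

/-- Modulo `b / a - c` the chart is covered by `A`: the elements of this shape form a subalgebra
containing `A` and `b / a`. -/
theorem IsRegularParameters.chart_decomp (h : IsRegularParameters A a b) (c : k) {g : F}
    (hg : g ∈ chart A a) : ∃ g₀ ∈ A, ∃ g₁ ∈ chart A a,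
      g = g₀ + (b / a - algebraMap k F c) * g₁ := by
  have ha := h.left_ne_zero
  have hz : b / a - algebraMap k F c ∈ chart A a :=
    (chart A a).sub_mem h.div_mem_chart ((chart A a).algebraMap_mem c)
  let B : Subalgebra k F :=
    { carrier := {g | ∃ g₀ ∈ A, ∃ g₁ ∈ chart A a, g = g₀ + (b / a - algebraMap k F c) * g₁}
      mul_mem' := by
        rintro _ _ ⟨g₀, h0, g₁, h1, rfl⟩ ⟨f₀, h2, f₁, h3, rfl⟩
        refine ⟨g₀ * f₀, A.mul_mem h0 h2,
          g₁ * f₀ + g₀ * f₁ + (b / a - algebraMap k F c) * (g₁ * f₁), ?_, by ring⟩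
        have h0' := le_chart A a h0
        have h2' := le_chart A a h2
        exact add_mem (add_mem (mul_mem h1 h2') (mul_mem h0' h3)) (mul_mem hz (mul_mem h1 h3))
      add_mem' := by
        rintro _ _ ⟨g₀, h0, g₁, h1, rfl⟩ ⟨f₀, h2, f₁, h3, rfl⟩
        exact ⟨g₀ + f₀, A.add_mem h0 h2, g₁ + f₁, add_mem h1 h3, by ring⟩
      algebraMap_mem' := fun d => ⟨_, A.algebraMap_mem d, 0, zero_mem _, by simp⟩ }
  refine h.chart_le (B := B) (fun x hx => ⟨x, hx, 0, zero_mem _, by simp⟩) ?_ hg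
  exact ⟨algebraMap k F c, A.algebraMap_mem c, 1, one_mem _, by ring⟩

theorem IsRegularParameters.isNoetherianRing_chart (h : IsRegularParameters A a b) :
    IsNoetherianRing (chart A a) := by
  have : IsRegularLocalRing A := h.1
  have hmem : ∀ P : Polynomial A, Polynomial.aeval (b / a) P ∈ chart A a := fun P => by
    induction P using Polynomial.induction_on' with
    | add p q hp hq => rw [map_add]; exact add_mem hp hq
    | monomial n r =>
      rw [Polynomial.aeval_monomial]
      exact mul_mem (le_chart A a r.2) (pow_mem h.div_mem_chart n)
  let φ : Polynomial A →+* chart A a :=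
    (Polynomial.aeval (R := A) (b / a)).toRingHom.codRestrict (chart A a) hmem
  refine isNoetherianRing_of_surjective _ _ φ ?_
  rintro ⟨g, hg⟩
  let B : Subalgebra k F :=
    { carrier := {g | ∃ P : Polynomial A, Polynomial.aeval (b / a) P = g}
      mul_mem' := by
        rintro _ _ ⟨P, rfl⟩ ⟨Q, rfl⟩
        exact ⟨P * Q, map_mul _ _ _⟩
      add_mem' := by
        rintro _ _ ⟨P, rfl⟩ ⟨Q, rfl⟩
        exact ⟨P + Q, map_add _ _ _⟩
      algebraMap_mem' := fun d => ⟨Polynomial.C (algebraMap k A d), by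
        rw [Polynomial.aeval_C]; rfl⟩ }
  obtain ⟨P, hP⟩ : g ∈ B := h.chart_le (B := B)
    (fun x hx => ⟨Polynomial.C ⟨x, hx⟩, by rw [Polynomial.aeval_C]; rfl⟩)
    ⟨Polynomial.X, Polynomial.aeval_X _⟩ hg
  exact ⟨P, Subtype.ext hP⟩

end QuadraticTransform

/-! ### A quadratic transform along the valuation is again regular. -/

section QuadraticTransform

variable {k F : Type*} [Field k] [Field F] [Algebra k F] {ν : AddValuation F (WithTop ℚ)}
  {A : Subalgebra k F} {a b : F}

/-- The prime is the contraction of the maximal ideal of `A_Q`, where `a` is a unit and hence `z =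
(a * z) / a` is not. -/
theorem exists_prime_of_le_fractions {A A' : Subalgebra k F} {Q : Ideal A} (hQ : Q.IsPrime)
    (hA' : A' ≤ fractions A Q.primeCompl) {a z : F} (ha : a ∈ A) (haQ : (⟨a, ha⟩ : A) ∉ Q)
    (ha' : a ∈ A') (hz : z ∈ A') (haz : a * z ∈ A) (hazQ : (⟨a * z, haz⟩ : A) ∈ Q) :
    ∃ P : Ideal A', P.IsPrime ∧ (⟨z, hz⟩ : A') ∈ P ∧ (⟨a, ha'⟩ : A') ∉ P := by
  let := (Subalgebra.inclusion (le_fractions A Q.primeCompl)).toRingHom.toAlgebra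
  have : IsLocalization.AtPrime (fractions A Q.primeCompl) Q :=
    isLocalization_fractions A Q.primeCompl (by simp [Ideal.primeCompl])
  have hloc := IsLocalization.AtPrime.isLocalRing (fractions A Q.primeCompl) Q
  let φ : A' →+* fractions A Q.primeCompl := (Subalgebra.inclusion hA').toRingHom
  have hφa : φ ⟨a, ha'⟩ = algebraMap A (fractions A Q.primeCompl) ⟨a, ha⟩ := rfl
  have hua : IsUnit (φ ⟨a, ha'⟩) := by
    rw [hφa, IsLocalization.AtPrime.isUnit_to_map_iff _ Q]; exact haQ
  have hφz : φ ⟨a, ha'⟩ * φ ⟨z, hz⟩ = algebraMap A (fractions A Q.primeCompl) ⟨a * z, haz⟩ := rfl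
  refine ⟨(IsLocalRing.maximalIdeal (fractions A Q.primeCompl)).comap φ, Ideal.comap_isPrime _ _,
    ?_, ?_⟩
  · rw [Ideal.mem_comap, IsLocalRing.mem_maximalIdeal, mem_nonunits_iff]
    intro hu
    have := hua.mul hu
    rw [hφz, IsLocalization.AtPrime.isUnit_to_map_iff _ Q] at this
    exact this hazQ
  · rw [Ideal.mem_comap, IsLocalRing.mem_maximalIdeal, mem_nonunits_iff, not_not]
    exact hua

/-- Two generators of the maximal ideal bound the dimension by 2; in dimension at most 1 the nonzero
prime `P` would be maximal and contain `a`. -/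
theorem isRegularParameters_of_prime {A : Subalgebra k F} [IsLocalRing A] [IsNoetherianRing A]
    {a b : F} (ha : a ∈ A) (hb : b ∈ A)
    (hm : IsLocalRing.maximalIdeal A = Ideal.span {(⟨a, ha⟩ : A), (⟨b, hb⟩ : A)})
    (hb0 : b ≠ 0) {P : Ideal A} (hP : P.IsPrime) (hbP : (⟨b, hb⟩ : A) ∈ P)
    (haP : (⟨a, ha⟩ : A) ∉ P) : IsRegularParameters A a b := by
  have h1 : ¬ ringKrullDim A ≤ 1 := by
    intro h
    have h' : Ring.KrullDimLE 1 A := Ring.krullDimLE_iff.2 (by exact_mod_cast h)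
    rw [Ring.krullDimLE_one_iff_of_noZeroDivisors] at h'
    have hmax : P.IsMaximal := h' P (fun h0 => by
      rw [h0, Ideal.mem_bot] at hbP
      exact hb0 (congrArg Subtype.val hbP)) hP
    have hle : P = IsLocalRing.maximalIdeal A := IsLocalRing.eq_maximalIdeal hmax
    apply haP
    rw [hle, hm]
    exact Ideal.subset_span (by simp)
  have h2 : (IsLocalRing.maximalIdeal A).spanFinrank ≤ 2 := by
    rw [hm]
    exact (Submodule.spanFinrank_span_le_ncard_of_finite (Set.toFinite _)).trans
      ((Set.ncard_insert_le _ _).trans (by simp))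
  have h3 := ringKrullDim_le_spanFinrank_maximalIdeal A
  have h4 : ringKrullDim A ≤ 2 := h3.trans (by exact_mod_cast h2)
  have h5 : ringKrullDim A = 2 := by
    generalize ringKrullDim A = d at h1 h4
    induction d with
    | bot => simp at h1
    | coe d =>
      induction d using ENat.recTopCoe with
      | top => exact absurd h4 (by decide)
      | coe n =>
        have h6 : ¬ n ≤ 1 := fun h => h1 (by exact_mod_cast h)
        have h5 : ((n : ℕ∞) : WithBot ℕ∞) ≤ ((2 : ℕ∞) : WithBot ℕ∞) := h4
        have h7 : n ≤ 2 := by exact_mod_cast WithBot.coe_le_coe.1 h5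
        obtain rfl : n = 2 := by omega
        rfl
  exact ⟨IsRegularLocalRing.of_spanFinrank_maximalIdeal_le A (by rw [h5]; exact_mod_cast h2),
    ha, hb, h5, hm⟩

variable {c : k}

theorem val_residue_nonneg (hA : Dominates ν A)
    (hc : 0 < ν (b / a - algebraMap k F c)) : 0 ≤ ν (b / a) := by
  have := ν.map_le_add hc.le (hA.val_algebraMap_nonneg c)
  simpa using this

theorem IsRegularParameters.val_chart_nonneg (h : IsRegularParameters A a b)
    (hA : Dominates ν A) (hba : 0 ≤ ν (b / a)) : ∀ g ∈ chart A a, 0 ≤ ν g := by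
  let B : Subalgebra k F :=
    { carrier := {g | 0 ≤ ν g}
      mul_mem' := fun {x y} hx hy => by
        change 0 ≤ ν (x * y)
        rw [ν.map_mul]; exact add_nonneg hx hy
      add_mem' := fun hx hy => ν.map_le_add hx hy
      algebraMap_mem' := hA.val_algebraMap_nonneg }
  exact fun g hg => h.chart_le (B := B) (fun x hx => (hA x hx).1) hba hg

/-- This inclusion lets the height-one prime `Q` of `A` define a prime of the transform (the strict
transform of the curve `f = 0`), which shows that the dimension does not drop. -/
theorem IsRegularParameters.quadraticTransform_le_fractions (h : IsRegularParameters A a b)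
    (hA : Dominates ν A) (hc : 0 < ν (b / a - algebraMap k F c)) {Q : Ideal A} (hQ : Q.IsPrime)
    (haQ : (⟨a, h.left_mem⟩ : A) ∉ Q)
    {f : F} (hf : f ∈ A) (hfQ : (⟨f, hf⟩ : A) ∈ Q) (hfa : f = a * (b / a - algebraMap k F c)) :
    localizeAtCentre ν (chart A a) ≤ fractions A Q.primeCompl := by
  have ha := h.left_ne_zero
  have h0 : ∀ d : A, d ∉ Q → (d : F) ≠ 0 := fun d hd h0 => hd (by
    rw [show d = 0 from Subtype.ext h0]; exact Q.zero_mem)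
  have hch : chart A a ≤ fractions A Q.primeCompl :=
    h.chart_le (le_fractions _ _) ⟨⟨b, h.right_mem⟩, ⟨a, h.left_mem⟩, haQ, ha, rfl⟩
  intro z hz
  obtain ⟨g, hg, e, he, he0, rfl⟩ := mem_localizeAtCentre.1 hz
  rw [div_eq_mul_inv]
  refine mul_mem (hch hg) ?_
  obtain ⟨e₀, h0A, e₁, h1, rfl⟩ := h.chart_decomp c he
  obtain ⟨n, d, hd, hd0, hnd⟩ := hch h1
  have hν₁ := h.val_chart_nonneg hA (val_residue_nonneg hA hc) e₁ h1
  -- A denominator of value zero is a unit `e₀` of `A` plus a multiple of `b / a - c`, and the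
  -- latter lies in the maximal ideal of `A_Q`.
  have hν₀ : ν e₀ = 0 := by
    by_contra hne
    have hpos : 0 < ν e₀ := lt_of_le_of_ne (hA e₀ h0A).1 (Ne.symm hne)
    have hpos' : 0 < ν ((b / a - algebraMap k F c) * e₁) := by
      rw [ν.map_mul]
      exact lt_of_lt_of_le hc (le_add_of_nonneg_right hν₁)
    exact (ν.map_lt_add hpos hpos').ne' he0
  have he₀Q : (⟨e₀, h0A⟩ : A) ∉ Q := fun hm => by
    have := Q.mul_mem_left ⟨e₀⁻¹, hA.inv_mem h0A hν₀⟩ hm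
    have h1 : (⟨e₀⁻¹, hA.inv_mem h0A hν₀⟩ * ⟨e₀, h0A⟩ : A) = 1 :=
      Subtype.ext (inv_mul_cancel₀ (ne_zero_of_val_eq_zero hν₀))
    rw [h1] at this
    exact hQ.ne_top (Ideal.eq_top_of_isUnit_mem _ this isUnit_one)
  let a' : A := ⟨a, h.left_mem⟩
  -- The denominator `e₀ + (b / a - c) * e₁` with `e₁ = n / d`, cleared by the factor `a * d`;
  -- modulo `Q` it is `e₀ * a * d`.
  let N : A := ⟨e₀, h0A⟩ * (a' * d) + ⟨f, hf⟩ * n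
  have hN : N ∉ Q := fun hm => by
    have h2 := (Ideal.add_mem_iff_left Q (Q.mul_mem_right n hfQ)).1 hm
    rcases hQ.mem_or_mem h2 with h3 | h3
    · exact he₀Q h3
    · rcases hQ.mem_or_mem h3 with h4 | h4
      · exact haQ h4
      · exact hd h4
  refine ⟨a' * d, N, hN, h0 N hN, ?_⟩
  have hNv : (N : F) = (e₀ + (b / a - algebraMap k F c) * e₁) * (a * d) := by
    change e₀ * (a * d) + f * n = _
    rw [hnd, hfa]
    field_simp
  rw [hNv]
  change _ = a * (d : F) / _
  rw [div_mul_cancel_right₀ (mul_ne_zero ha hd0)]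

theorem quadratic_transform (hA : Dominates ν A) (h : IsRegularParameters A a b)
    (hc : 0 < ν (b / a - algebraMap k F c)) :
    IsQuadraticTransform A (localizeAtCentre ν (chart A a)) ∧
    Dominates ν (localizeAtCentre ν (chart A a)) ∧
    IsRegularParameters (localizeAtCentre ν (chart A a)) a (b / a - algebraMap k F c) := by
  have hba := val_residue_nonneg hA hc
  have hB := h.val_chart_nonneg hA hba
  have hdom := dominates_localizeAtCentre hB
  have hp := centre_isPrime hB
  have hle := le_localizeAtCentre (ν := ν) (chart A a)
  have ha := h.left_ne_zero
  refine ⟨⟨hA.isLocalRing, a, h.left_mem_maxSet, ha, centre ν _ hB, hp, fun g hg => ?_,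
    localizeAtCentre_eq hB⟩, hdom, ?_⟩
  · exact (hA g hg).2
  have hloc := hdom.isLocalRing
  have hnoeth : IsNoetherianRing (localizeAtCentre ν (chart A a)) := by
    have := h.isNoetherianRing_chart
    rw [localizeAtCentre_eq hB]
    exact isNoetherianRing_fractions _ _ (by simp [Ideal.primeCompl])
  have hzc : b / a - algebraMap k F c ∈ chart A a :=
    sub_mem h.div_mem_chart ((chart A a).algebraMap_mem c)
  have h' : IsRegularParameters A a (a * (b / a - algebraMap k F c)) := by
    have := h.change_right (s := 1) (r := -algebraMap k F c) A.one_mem (by simp)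
      one_ne_zero (neg_mem (A.algebraMap_mem c))
    convert this using 1
    field_simp
    ring
  obtain ⟨Q, hQ, hfQ, haQ⟩ := h'.exists_prime
  have ha1 := hle (le_chart A a h.left_mem)
  obtain ⟨P, hP, hzP, haP⟩ := exists_prime_of_le_fractions hQ
    (h.quadraticTransform_le_fractions hA hc hQ haQ h'.right_mem hfQ rfl) h.left_mem haQ ha1
    (hle hzc) h'.right_mem hfQ
  refine isRegularParameters_of_prime ha1 (hle hzc) ?_
    (right_ne_zero_of_mul h'.right_ne_zero) hP hzP haP
  apply le_antisymm
  · intro g hg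
    rw [hdom.mem_maximalIdeal_iff] at hg
    obtain ⟨n, hn, d, hd, hd0, hgd⟩ := mem_localizeAtCentre.1 g.2
    rw [hgd, val_div_of_val_eq_zero hd0] at hg
    obtain ⟨n₀, h0, n₁, h1, rfl⟩ := h.chart_decomp c hn
    have hpos : 0 < ν n₀ := by
      have h2 : 0 < ν ((b / a - algebraMap k F c) * n₁) := by
        rw [ν.map_mul]
        exact lt_of_lt_of_le hc (le_add_of_nonneg_right (hB n₁ h1))
      have h3 := ν.map_lt_add hg (by rwa [ν.map_neg] : 0 < ν (-((b / a - algebraMap k F c) * n₁)))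
      simpa using h3
    obtain ⟨r, hr, s, hs, hrs⟩ := h'.exists_eq_add hA h0 hpos
    have hdinv := hdom.inv_mem (hle hd) hd0
    refine Ideal.mem_span_pair.2 ⟨⟨(r + s * (b / a - algebraMap k F c)) * d⁻¹, ?_⟩,
      ⟨n₁ * d⁻¹, mul_mem (hle h1) hdinv⟩, Subtype.ext ?_⟩
    · exact mul_mem (add_mem (hle (le_chart A a hr))
        (mul_mem (hle (le_chart A a hs)) (hle hzc))) hdinv
    · change (r + s * (b / a - algebraMap k F c)) * d⁻¹ * a +
        n₁ * d⁻¹ * (b / a - algebraMap k F c) = g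
      rw [hgd, hrs]
      ring
  · rw [Ideal.span_le]
    rintro g (rfl | rfl)
    · exact (hdom.mem_maximalIdeal_iff _).2 (h.val_left_pos hA)
    · exact (hdom.mem_maximalIdeal_iff _).2 hc

end QuadraticTransform

/-! ### Euclid's algorithm by quadratic transforms. -/

section MonomialTransform

variable {k F : Type*} [Field k] [Field F] [Algebra k F] {ν : AddValuation F (WithTop ℚ)}

/-- `γ ∈ A` has value zero; if `ν` dominates `A`, then this says that `γ` is a unit of `A`. -/
def IsUnitAt (ν : AddValuation F (WithTop ℚ)) (A : Subalgebra k F) (γ : F) : Prop :=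
  γ ∈ A ∧ ν γ = 0

namespace IsUnitAt

variable {A B : Subalgebra k F} {γ η : F}

theorem ne_zero (h : IsUnitAt ν A γ) : γ ≠ 0 := ne_zero_of_val_eq_zero h.2

theorem mono (h : IsUnitAt ν A γ) (hAB : A ≤ B) : IsUnitAt ν B γ := ⟨hAB h.1, h.2⟩

theorem one : IsUnitAt ν A 1 := ⟨A.one_mem, ν.map_one⟩

theorem mul (h : IsUnitAt ν A γ) (h' : IsUnitAt ν A η) : IsUnitAt ν A (γ * η) :=
  ⟨A.mul_mem h.1 h'.1, by rw [ν.map_mul, h.2, h'.2, add_zero]⟩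

theorem inv (h : IsUnitAt ν A γ) (hA : Dominates ν A) : IsUnitAt ν A γ⁻¹ :=
  ⟨hA.inv_mem h.1 h.2, val_inv_eq_zero h.2⟩

theorem div (h : IsUnitAt ν A γ) (h' : IsUnitAt ν A η) (hA : Dominates ν A) :
    IsUnitAt ν A (γ / η) := by
  rw [div_eq_mul_inv]; exact h.mul (h'.inv hA)

theorem pow (h : IsUnitAt ν A γ) (n : ℕ) : IsUnitAt ν A (γ ^ n) :=
  ⟨A.pow_mem h.1 n, by rw [ν.map_pow, h.2, smul_zero]⟩

theorem zpow (h : IsUnitAt ν A γ) (hA : Dominates ν A) (n : ℤ) : IsUnitAt ν A (γ ^ n) := by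
  obtain ⟨m, rfl | rfl⟩ := n.eq_nat_or_neg
  · rw [zpow_natCast]; exact h.pow m
  · rw [zpow_neg, zpow_natCast]; exact (h.pow m).inv hA

/-- By Bézout, `γ` is a product of integral powers of `γ ^ m` and `γ ^ n`. -/
theorem of_pow_of_pow (hA : Dominates ν A) (h0 : γ ≠ 0) {m n : ℕ} (hmn : m.Coprime n)
    (hm : IsUnitAt ν A (γ ^ m)) (hn : IsUnitAt ν A (γ ^ n)) : IsUnitAt ν A γ := by
  have hb := Nat.gcd_eq_gcd_ab m n
  rw [hmn] at hb
  have : γ = (γ ^ m) ^ (m.gcdA n) * (γ ^ n) ^ (m.gcdB n) := by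
    rw [← zpow_natCast, ← zpow_natCast, ← zpow_mul, ← zpow_mul, ← zpow_add₀ h0, ← hb]
    simp
  rw [this]
  exact (hm.zpow hA _).mul (hn.zpow hA _)

end IsUnitAt

variable {A : Subalgebra k F} {a b : F}

theorem QuadraticSequence.le {A A' : Subalgebra k F} (h : QuadraticSequence ν A A') : A ≤ A' := by
  induction h with
  | refl => exact le_rfl
  | tail _ h ih =>
    obtain ⟨⟨_, x, _, _, P, _, _, rfl⟩, _⟩ := h
    exact ih.trans ((le_chart _ x).trans (le_fractions _ _))

theorem QuadraticSequence.dominates {A A' : Subalgebra k F} (h : QuadraticSequence ν A A')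
    (hA : Dominates ν A) : Dominates ν A' := by
  cases h with
  | refl => exact hA
  | tail _ h => exact h.2

/-- The data of a sequence of quadratic transforms which makes `a` and `b` associated to powers
`a' ^ q` and `a' ^ p` of one regular parameter `a'`. -/
def IsMonomialTransform (ν : AddValuation F (WithTop ℚ)) (A A' : Subalgebra k F) (a b a' : F)
    (p q : ℕ) : Prop :=
  QuadraticSequence ν A A' ∧
  (∃ γ, IsUnitAt ν A' γ ∧ a = a' ^ q * γ) ∧
  (∃ γ, IsUnitAt ν A' γ ∧ b = a' ^ p * γ) ∧
  ∀ B : Subalgebra k F, A ≤ B → (∀ x ∈ B, ν x = 0 → x⁻¹ ∈ B) →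
    (∀ i j : ℤ, 0 ≤ ν (a ^ i * b ^ j) → a ^ i * b ^ j ∈ B) → A' ≤ B

/-- Here `q * ν b = p * ν a`, so comparing values is comparing `p` with `q`. A quadratic transform
divides the parameter of larger value by the other one and subtracts the smaller exponent from the
larger. The ratio `b ^ q / a ^ p` never changes, and at `p = q = 1` it is `b / a`, whose residue `c`
is subtracted. `N` only bounds `p + q` for the induction. -/
theorem exists_monomialTransform (N : ℕ) : ∀ (p q : ℕ) (A : Subalgebra k F) (a b : F) (c : k),
    p + q ≤ N → 0 < p → 0 < q → p.Coprime q → Dominates ν A → IsRegularParameters A a b →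
    0 < ν (b ^ q / a ^ p - algebraMap k F c) → ν (b ^ q / a ^ p) = 0 →
    ∃ A' a', IsMonomialTransform ν A A' a b a' p q ∧
      IsRegularParameters A' a' (b ^ q / a ^ p - algebraMap k F c) := by
  induction N with
  | zero => intros; omega
  | succ N ih =>
  intro p q A a b c hN hp hq hpq hA h hc hv
  have ha0 := h.left_ne_zero
  have hb0 := h.right_ne_zero
  obtain ⟨r, hr⟩ := exists_val_eq ν ha0
  obtain ⟨s, hs⟩ := exists_val_eq ν hb0
  have hr0 : 0 < r := by have := h.val_left_pos hA; rw [hr] at this; exact_mod_cast this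
  have hs0 : 0 < s := by have := h.val_right_pos hA; rw [hs] at this; exact_mod_cast this
  have hrs : (q : ℚ) * s = p * r := by
    rw [val_div_eq (val_pow_eq hs q) (val_pow_eq hr p)] at hv
    norm_cast at hv
    linarith
  rcases lt_trichotomy p q with hlt | heq | hlt
  · -- the value of `a` is bigger than that of `b`
    have hsr : s < r := by
      have : (p : ℚ) < q := by exact_mod_cast hlt
      have hp' : (0 : ℚ) < p := by exact_mod_cast hp
      nlinarith
    have hc1 : 0 < ν (a / b - algebraMap k F 0) := by
      rw [map_zero, sub_zero, val_div_eq hr hs]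
      have : 0 < r - s := by linarith
      exact_mod_cast this
    obtain ⟨hQ, hD, hreg⟩ := quadratic_transform hA h.symm hc1
    have hreg' := hreg.symm
    rw [map_zero, sub_zero] at hreg'
    set A1 := localizeAtCentre ν (chart A b) with hA1
    have he : b ^ (q - p) / (a / b) ^ p = b ^ q / a ^ p := by
      rw [pow_sub₀ _ hb0 hlt.le, div_pow]
      field_simp
    obtain ⟨A', a', ⟨hS, ⟨γ, hγ, hγe⟩, ⟨η, hη, hηe⟩, huniv⟩, hreg2⟩ :=
      ih p (q - p) A1 (a / b) b c (by omega) hp (by omega)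
        ((Nat.coprime_sub_self_right hlt.le).2 hpq) hD hreg' (by rwa [he]) (by rwa [he])
    rw [he] at hreg2
    refine ⟨A', a', ⟨hS.head ⟨hQ, hD⟩, ⟨γ * η, hγ.mul hη, ?_⟩, ⟨η, hη, hηe⟩, ?_⟩, hreg2⟩
    · have : a = (a / b) * b := by field_simp
      rw [this, hγe]
      rw [hηe]
      obtain ⟨d, rfl⟩ := Nat.exists_eq_add_of_lt hlt
      rw [show p + d + 1 - p = d + 1 by omega]
      ring
    · intro B hAB hinv hmon
      -- Laurent monomials in the new parameters are Laurent monomials in the old ones, so the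
      -- minimality clause passes back to `A`.
      have key : ∀ i j : ℤ, (a / b) ^ i * b ^ j = a ^ i * b ^ (j - i) := fun i j => by
        rw [div_zpow, zpow_sub₀ hb0]
        field_simp
      refine huniv B (localizeAtCentre_le (h.symm.chart_le hAB ?_) hinv) hinv fun i j hij => ?_
      · have := hmon 1 (-1)
        simp only [zpow_one, zpow_neg, ← div_eq_mul_inv] at this
        apply this
        rw [val_div_eq hr hs]
        have : 0 ≤ r - s := by linarith
        exact_mod_cast this
      · rw [key] at hij ⊢
        exact hmon _ _ hij
  · subst heq
    obtain rfl : p = 1 := by simpa using hpq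
    rw [pow_one, pow_one] at hc hv ⊢
    obtain ⟨hQ, hD, hreg⟩ := quadratic_transform hA h hc
    have hba := le_localizeAtCentre (ν := ν) _ h.div_mem_chart
    refine ⟨_, a, ⟨Relation.ReflTransGen.single ⟨hQ, hD⟩, ⟨1, .one, by simp⟩,
      ⟨b / a, ⟨hba, hv⟩, by field_simp⟩, ?_⟩, hreg⟩
    intro B hAB hinv hmon
    refine localizeAtCentre_le (h.chart_le hAB ?_) hinv
    have := hmon (-1) 1
    simp only [zpow_one, zpow_neg, ← div_eq_inv_mul] at this
    exact this hv.ge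
  · have hsr : r < s := by
      have : (q : ℚ) < p := by exact_mod_cast hlt
      have hq' : (0 : ℚ) < q := by exact_mod_cast hq
      nlinarith
    have hc1 : 0 < ν (b / a - algebraMap k F 0) := by
      rw [map_zero, sub_zero, val_div_eq hs hr]
      have : 0 < s - r := by linarith
      exact_mod_cast this
    obtain ⟨hQ, hD, hreg⟩ := quadratic_transform hA h hc1
    rw [map_zero, sub_zero] at hreg
    set A1 := localizeAtCentre ν (chart A a) with hA1
    have he : (b / a) ^ q / a ^ (p - q) = b ^ q / a ^ p := by
      rw [pow_sub₀ _ ha0 hlt.le, div_pow]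
      field_simp
    obtain ⟨A', a', ⟨hS, ⟨γ, hγ, hγe⟩, ⟨η, hη, hηe⟩, huniv⟩, hreg2⟩ :=
      ih (p - q) q A1 a (b / a) c (by omega) (by omega) hq
        ((Nat.coprime_sub_self_left hlt.le).2 hpq) hD hreg (by rwa [he]) (by rwa [he])
    rw [he] at hreg2
    refine ⟨A', a', ⟨hS.head ⟨hQ, hD⟩, ⟨γ, hγ, hγe⟩, ⟨η * γ, hη.mul hγ, ?_⟩, ?_⟩, hreg2⟩
    · have : b = (b / a) * a := by field_simp
      rw [this, hηe]
      rw [hγe]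
      obtain ⟨d, rfl⟩ := Nat.exists_eq_add_of_lt hlt
      rw [show q + d + 1 - q = d + 1 by omega]
      ring
    · intro B hAB hinv hmon
      have key : ∀ i j : ℤ, a ^ i * (b / a) ^ j = a ^ (i - j) * b ^ j := fun i j => by
        rw [div_zpow, zpow_sub₀ ha0]
        field_simp
      refine huniv B (localizeAtCentre_le (h.chart_le hAB ?_) hinv) hinv fun i j hij => ?_
      · have := hmon (-1) 1
        simp only [zpow_one, zpow_neg, ← div_eq_inv_mul] at this
        apply this
        rw [val_div_eq hs hr]
        have : 0 ≤ s - r := by linarith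
        exact_mod_cast this
      · rw [key] at hij ⊢
        exact hmon _ _ hij

variable [CharZero k]

/-- A second parameter `z - c` may be replaced by `z ^ e * γ - d` if `γ` is a unit of a ring whose
maximal ideal becomes divisible by the first parameter. -/
theorem IsRegularParameters.pow_mul_sub {A' : Subalgebra k F} {a' z γ : F} {c d : k} {e : ℕ}
    (hres : ∀ f : F, 0 ≤ ν f → ∃ c : k, 0 < ν (f - algebraMap k F c))
    (hA : Dominates ν A) (hA' : Dominates ν A')
    (hdiv : ∀ f ∈ A, 0 < ν f → ∃ g ∈ A', f = a' * g)
    (hz0 : ν z = 0) (h : IsRegularParameters A' a' (z - algebraMap k F c)) (he : 0 < e)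
    (hγ : IsUnitAt ν A γ) (hd : 0 < ν (z ^ e * γ - algebraMap k F d)) :
    IsRegularParameters A' a' (z ^ e * γ - algebraMap k F d) := by
  obtain ⟨γ₀, hγ₀⟩ := hres γ hγ.2.ge
  obtain ⟨r, hr, hγr⟩ := hdiv _ (sub_mem hγ.1 (A.algebraMap_mem γ₀)) hγ₀
  set y := z - algebraMap k F c with hy
  have hypos : 0 < ν y := h.val_right_pos hA'
  have hzA' : z ∈ A' := by
    have := add_mem h.right_mem (A'.algebraMap_mem c)
    simpa [hy] using this
  have hc0 : c ≠ 0 := by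
    rintro rfl
    rw [hy, map_zero, sub_zero, hz0] at hypos
    exact hypos.ne rfl
  have hγ0 : γ₀ ≠ 0 := by
    rintro rfl
    rw [map_zero, sub_zero, hγ.2] at hγ₀
    exact hγ₀.ne rfl
  -- Taylor expansion of `z ^ e = (c + y) ^ e`. The linear coefficient `e * c ^ (e - 1)` is nonzero
  -- in characteristic 0, so `s` below, the cofactor of `y` in `z ^ e * γ - d`, is a unit.
  obtain ⟨⟨w, hw⟩, hexp⟩ := Polynomial.powAddExpansion (⟨algebraMap k F c, A'.algebraMap_mem c⟩ : A')
    ⟨y, h.right_mem⟩ e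
  have hexp' : z ^ e = algebraMap k F c ^ e + e * algebraMap k F c ^ (e - 1) * y + w * y ^ 2 := by
    have := congrArg (Subtype.val) hexp
    push_cast at this
    rw [← this]
    simp [hy]
  set s := algebraMap k F (γ₀ * (e * c ^ (e - 1))) + algebraMap k F γ₀ * w * y with hs
  have hsA : s ∈ A' := add_mem (A'.algebraMap_mem _)
    (mul_mem (mul_mem (A'.algebraMap_mem _) hw) h.right_mem)
  have hs0 : ν s = 0 := by
    have h1 : ν (algebraMap k F (γ₀ * (e * c ^ (e - 1)))) = 0 :=
      hA.val_algebraMap (mul_ne_zero hγ0 (mul_ne_zero (by exact_mod_cast he.ne')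
        (pow_ne_zero _ hc0)))
    have h2 : 0 < ν (algebraMap k F γ₀ * w * y) := by
      rw [ν.map_mul]
      exact lt_of_lt_of_le hypos (le_add_of_nonneg_left
        (hA' _ (mul_mem (A'.algebraMap_mem _) hw)).1)
    rw [hs, ν.map_add_eq_of_lt_left (by rwa [h1]), h1]
  have hid : z ^ e * γ - algebraMap k F d =
      y * s + a' * (z ^ e * r) + algebraMap k F (γ₀ * c ^ e - d) := by
    have : γ = algebraMap k F γ₀ + a' * r := by rw [← hγr]; ring
    rw [this, mul_add, hexp', hs]
    simp only [map_sub, map_mul, map_pow, map_natCast]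
    ring
  -- Residues are unique: `γ₀ * c ^ e` and `d` are both the residue of `z ^ e * γ`.
  have hconst : γ₀ * c ^ e - d = 0 := by
    by_contra hne
    have h1 := hA.val_algebraMap hne
    have h2 : 0 < ν (y * s + a' * (z ^ e * r)) := by
      refine ν.map_lt_add ?_ ?_
      · rw [ν.map_mul, hs0, add_zero]; exact hypos
      · rw [ν.map_mul]
        exact lt_of_lt_of_le (h.val_left_pos hA') (le_add_of_nonneg_right
          (hA' _ (mul_mem (pow_mem hzA' e) hr)).1)
    rw [hid, ν.map_add_eq_of_lt_right (by rwa [h1]), h1] at hd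
    exact hd.ne rfl
  rw [hid, hconst, map_zero, add_zero]
  exact h.change_right hsA (hA'.inv_mem hsA hs0) (ne_zero_of_val_eq_zero hs0)
    (mul_mem (pow_mem hzA' e) hr)

theorem exists_monomialTransform_regularParameters
    (hres : ∀ f : F, 0 ≤ ν f → ∃ c : k, 0 < ν (f - algebraMap k F c))
    {p q : ℕ} (hp : 0 < p) (hq : 0 < q) (hpq : p.Coprime q) (hA : Dominates ν A)
    (h : IsRegularParameters A a b) (hv : ν (b ^ q / a ^ p) = 0) :
    ∃ A' a', IsMonomialTransform ν A A' a b a' p q ∧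
      ∀ (e : ℕ) (γ : F) (d : k), 0 < e → IsUnitAt ν A γ →
        0 < ν ((b ^ q / a ^ p) ^ e * γ - algebraMap k F d) →
        IsRegularParameters A' a' ((b ^ q / a ^ p) ^ e * γ - algebraMap k F d) := by
  obtain ⟨c, hc⟩ := hres _ hv.ge
  obtain ⟨A', a', hM, hreg⟩ := exists_monomialTransform _ p q A a b c le_rfl hp hq hpq hA h hc hv
  refine ⟨A', a', hM, fun e γ d he hγ hd => ?_⟩
  obtain ⟨hS, ⟨γ₁, hγ₁, h1⟩, ⟨γ₂, hγ₂, h2⟩, -⟩ := hM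
  refine hreg.pow_mul_sub hres hA (hS.dominates hA) (fun f hf hfpos => ?_) hv he hγ hd
  obtain ⟨r, hr, s, hs, rfl⟩ := h.exists_eq_add hA hf hfpos
  have ha' := hreg.left_mem
  refine ⟨r * (a' ^ (q - 1) * γ₁) + s * (a' ^ (p - 1) * γ₂), ?_, ?_⟩
  · exact add_mem (mul_mem (hS.le hr) (mul_mem (pow_mem ha' _) hγ₁.1))
      (mul_mem (hS.le hs) (mul_mem (pow_mem ha' _) hγ₂.1))
  · rw [h1, h2]
    obtain ⟨q, rfl⟩ := Nat.exists_eq_succ_of_ne_zero hq.ne'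
    obtain ⟨p, rfl⟩ := Nat.exists_eq_succ_of_ne_zero hp.ne'
    simp only [Nat.succ_eq_add_one, Nat.add_sub_cancel]
    ring

end MonomialTransform

/-! ### Simultaneous transforms of `R` and `S`. -/

section ToricPair

variable {k K E : Type*} [Field k] [Field K] [Field E] [Algebra k K] [Algebra k E] [Algebra K E]
  {ν : AddValuation E (WithTop ℚ)}

/-- The rings `R ⊆ S` are dominated by `ν`, and `U` is associated to `X ^ t` in `S`. -/
def IsToricPair (ν : AddValuation E (WithTop ℚ)) (R : Subalgebra k K) (S : Subalgebra k E)
    (U : K) (X : E) (t : ℕ) : Prop :=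
  Dominates (ν.comap (algebraMap K E)) R ∧ Dominates ν S ∧ (∀ a ∈ R, algebraMap K E a ∈ S) ∧
    ∃ Δ, IsUnitAt ν S Δ ∧ algebraMap K E U = X ^ t * Δ

variable {R : Subalgebra k K} {S : Subalgebra k E} {U b : K} {X : E}

theorem IsToricPair.localDominates {t : ℕ} (h : IsToricPair ν R S U X t) : LocalDominates R S :=
  fun a ha => ⟨h.2.2.1 a ha, ((h.2.1 _ (h.2.2.1 a ha)).2).symm.trans (h.1 a ha).2⟩

theorem exists_residue_comap [IsScalarTower k K E]
    (hres : ∀ f : E, 0 ≤ ν f → ∃ c : k, 0 < ν (f - algebraMap k E c)) :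
    ∀ f : K, 0 ≤ ν.comap (algebraMap K E) f →
      ∃ c : k, 0 < ν.comap (algebraMap K E) (f - algebraMap k K c) := fun f hf => by
  obtain ⟨c, hc⟩ := hres (algebraMap K E f) hf
  refine ⟨c, ?_⟩
  change 0 < ν (algebraMap K E (f - algebraMap k K c))
  rwa [map_sub, ← IsScalarTower.algebraMap_apply k K E]

/-- The ratios governing the two rings are `b ^ q / X ^ (p * g)` and `b ^ (t * q) / U ^ p`; the
second is the `t`-th power of the first up to a unit of `S`. Both exponent pairs are coprime, so
Euclid's algorithm applies to each ring separately. The case `t = 1` serves before the first failure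
of divisibility, the general case at the failure. -/
theorem IsToricPair.exists_transform [IsScalarTower k K E] [CharZero k]
    (hres : ∀ f : E, 0 ≤ ν f → ∃ c : k, 0 < ν (f - algebraMap k E c))
    {p t g q : ℕ} (hp : 0 < p) (ht : 0 < t) (hg : 0 < g) (hq : 0 < q) (htp : t.Coprime p)
    (hpq : (p * g).Coprime q) (h : IsToricPair ν R S U X (t * g))
    (hR : IsRegularParameters R U b) (hS : IsRegularParameters S X (algebraMap K E b))
    (hv : ν (algebraMap K E b ^ q / X ^ (p * g)) = 0) :
    ∃ R' S' U' X', QuadraticSequence (ν.comap (algebraMap K E)) R R' ∧ QuadraticSequence ν S S' ∧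
      IsToricPair ν R' S' U' X' g ∧
      (∃ γ, IsUnitAt (ν.comap (algebraMap K E)) R' γ ∧ U = U' ^ (t * q) * γ) ∧
      (∃ γ, IsUnitAt (ν.comap (algebraMap K E)) R' γ ∧ b = U' ^ p * γ) ∧
      (∃ γ, IsUnitAt ν S' γ ∧ X = X' ^ q * γ) ∧
      ∀ (γ : K) (d : k), IsUnitAt (ν.comap (algebraMap K E)) R γ →
        0 < ν.comap (algebraMap K E) (b ^ (t * q) / U ^ p * γ - algebraMap k K d) →
        IsRegularParameters R' U' (b ^ (t * q) / U ^ p * γ - algebraMap k K d) ∧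
        IsRegularParameters S' X'
          (algebraMap K E (b ^ (t * q) / U ^ p * γ - algebraMap k K d)) := by
  obtain ⟨hRd, hSd, hRS, Δ, hΔ, hU⟩ := id h
  have hX0 := hS.left_ne_zero
  have hU0 := hR.left_ne_zero
  have hΔ0 := hΔ.ne_zero
  have hΔp := (hΔ.pow p).inv hSd
  have hid : algebraMap K E (b ^ (t * q) / U ^ p) =
      (algebraMap K E b ^ q / X ^ (p * g)) ^ t * (Δ ^ p)⁻¹ := by
    rw [map_div₀, map_pow, map_pow, hU, div_pow, ← pow_mul, ← pow_mul, mul_pow, ← pow_mul,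
      show t * g * p = p * g * t by ring, mul_comm q t]
    field_simp
  have hvR : ν.comap (algebraMap K E) (b ^ (t * q) / U ^ p) = 0 := by
    change ν (algebraMap K E (b ^ (t * q) / U ^ p)) = 0
    rw [hid, ν.map_mul, ν.map_pow, hv, hΔp.2, smul_zero, add_zero]
  have hcopR : p.Coprime (t * q) :=
    Nat.Coprime.mul_right htp.symm (Nat.Coprime.coprime_mul_right hpq)
  obtain ⟨R', U', ⟨hRR', ⟨γ₁, hγ₁, hUe⟩, ⟨γ₂, hγ₂, hbe⟩, huniv⟩, hregR⟩ :=
    exists_monomialTransform_regularParameters (exists_residue_comap hres) hp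
      (Nat.mul_pos ht hq) hcopR hRd hR hvR
  obtain ⟨S', X', ⟨hSS', ⟨η₁, hη₁, hXe⟩, ⟨η₂, hη₂, hbe'⟩, -⟩, hregS⟩ :=
    exists_monomialTransform_regularParameters hres (Nat.mul_pos hp hg) hq hpq hSd hS hv
  have hR'd := hRR'.dominates hRd
  have hS'd := hSS'.dominates hSd
  have hU'0 : U' ≠ 0 := by
    rintro rfl
    rw [zero_pow (Nat.mul_pos ht hq).ne', zero_mul] at hUe
    exact hU0 hUe
  have hX'0 : X' ≠ 0 := by
    rintro rfl
    rw [zero_pow hq.ne', zero_mul] at hXe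
    exact hX0 hXe
  have hX'mem : X' ∈ S' := by
    obtain ⟨d, hd⟩ := hres _ hv.ge
    have := hregS 1 1 d one_pos .one (by simpa using hd)
    exact this.left_mem
  have hX'pos : 0 < ν X' := by
    have h1 := hS.val_left_pos hSd
    rw [hXe, ν.map_mul, hη₁.2, add_zero] at h1
    by_contra hc
    have h2 : ν X' = 0 := le_antisymm (not_lt.1 hc) (hS'd _ hX'mem).1
    rw [ν.map_pow, h2, smul_zero] at h1
    exact h1.ne rfl
  obtain ⟨ξ, hξ⟩ := exists_val_eq ν hX'0
  have hξ0 : 0 < ξ := by rw [hξ] at hX'pos; exact_mod_cast hX'pos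
  -- Minimality of `R'` is applied to the contraction of `S'` to `K`: in `S'` each `U ^ i * b ^ j`
  -- is a power of `X'` times a unit, and a nonnegative value forces a nonnegative exponent.
  have hmap : ∀ a ∈ R', algebraMap K E a ∈ S' := by
    refine huniv (S'.comap (IsScalarTower.toAlgHom k K E)) (fun a ha => hSS'.le (hRS a ha))
      (fun x hx h0 => ?_) (fun i j hij => ?_)
    · change algebraMap K E x⁻¹ ∈ S'
      rw [map_inv₀]
      exact hS'd.inv_mem hx h0
    · change algebraMap K E (U ^ i * b ^ j) ∈ S'
      change 0 ≤ ν (algebraMap K E (U ^ i * b ^ j)) at hij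
      have hΔ' : IsUnitAt ν S' Δ := hΔ.mono hSS'.le
      have hunit := (((hη₁.pow (t * g)).mul hΔ').zpow hS'd i).mul (hη₂.zpow hS'd j)
      have he : algebraMap K E (U ^ i * b ^ j) = X' ^ ((q * (t * g) : ℕ) * i + (p * g : ℕ) * j) *
          ((η₁ ^ (t * g) * Δ) ^ i * η₂ ^ j) := by
        rw [map_mul, map_zpow₀, map_zpow₀, hU, hXe, hbe', zpow_add₀ hX'0, zpow_mul, zpow_mul,
          zpow_natCast, zpow_natCast, mul_pow, ← pow_mul, mul_assoc, mul_zpow, mul_zpow _ η₂]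
        ring
      rw [he, ν.map_mul, hunit.2, add_zero, val_zpow_eq hξ] at hij
      have hn : 0 ≤ ((q * (t * g) : ℕ) * i + (p * g : ℕ) * j : ℤ) := by
        by_contra! hneg
        have h1 : (((q * (t * g) : ℕ) * i + (p * g : ℕ) * j : ℤ) : ℚ) < 0 := by exact_mod_cast hneg
        have h2 := mul_neg_of_neg_of_pos h1 hξ0
        exact absurd hij (not_le.2 (by exact_mod_cast h2))
      obtain ⟨n, hn⟩ := Int.eq_ofNat_of_zero_le hn
      rw [he, hn, zpow_natCast]
      exact mul_mem (pow_mem hX'mem n) hunit.1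
  have hΔ' : IsUnitAt ν S' Δ := hΔ.mono hSS'.le
  have hγ₁' : IsUnitAt ν S' (algebraMap K E γ₁) := ⟨hmap _ hγ₁.1, hγ₁.2⟩
  have hγ₂' : IsUnitAt ν S' (algebraMap K E γ₂) := ⟨hmap _ hγ₂.1, hγ₂.2⟩
  -- Comparing the two expressions of `b`, then those of `U`, shows that the `p`-th and the `(t *
  -- q)`-th powers are units.
  have hquot : IsUnitAt ν S' (algebraMap K E U' / X' ^ g) := by
    have hU'0' : algebraMap K E U' ≠ 0 := (map_ne_zero _).2 hU'0
    refine IsUnitAt.of_pow_of_pow hS'd (div_ne_zero hU'0' (pow_ne_zero _ hX'0)) hcopR ?_ ?_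
    · have : (algebraMap K E U' / X' ^ g) ^ p = η₂ / algebraMap K E γ₂ := by
        have h1 : algebraMap K E U' ^ p * algebraMap K E γ₂ = X' ^ (p * g) * η₂ := by
          rw [← map_pow, ← map_mul, ← hbe, hbe']
        have := hγ₂'.ne_zero
        rw [div_pow, ← pow_mul, mul_comm g p]
        field_simp
        rw [h1, mul_comm]
      rw [this]
      exact hη₂.div hγ₂' hS'd
    · have : (algebraMap K E U' / X' ^ g) ^ (t * q) = η₁ ^ (t * g) * Δ / algebraMap K E γ₁ := by
        have h1 : algebraMap K E U' ^ (t * q) * algebraMap K E γ₁ =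
            X' ^ (g * (t * q)) * (η₁ ^ (t * g) * Δ) := by
          rw [← map_pow, ← map_mul, ← hUe, hU, hXe]
          ring
        have := hγ₁'.ne_zero
        rw [div_pow, ← pow_mul]
        field_simp
        rw [h1]
        ring
      rw [this]
      exact ((hη₁.pow _).mul hΔ').div hγ₁' hS'd
  refine ⟨R', S', U', X', hRR', hSS', ⟨hR'd, hS'd, hmap, _, hquot, ?_⟩, ⟨γ₁, hγ₁, hUe⟩,
    ⟨γ₂, hγ₂, hbe⟩, ⟨η₁, hη₁, hXe⟩, fun γ d hγ hd => ⟨?_, ?_⟩⟩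
  · field_simp
  · have := hregR 1 γ d one_pos hγ (by rwa [pow_one])
    rwa [pow_one] at this
  · have he : algebraMap K E (b ^ (t * q) / U ^ p * γ - algebraMap k K d) =
        (algebraMap K E b ^ q / X ^ (p * g)) ^ t * ((Δ ^ p)⁻¹ * algebraMap K E γ) -
          algebraMap k E d := by
      rw [map_sub, map_mul, hid, ← IsScalarTower.algebraMap_apply k K E, mul_assoc]
    rw [he]
    refine hregS t _ d ht (hΔp.mul ⟨hRS _ hγ.1, hγ.2⟩) ?_
    rw [← he]
    exact hd

end ToricPair

/-! ### Laurent monomials up to units. -/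

section MonomialAt

variable {k F : Type*} [Field k] [Field F] [Algebra k F] {ν : AddValuation F (WithTop ℚ)}
  {A A' : Subalgebra k F} {U U' f g : F}

/-- `f` is a Laurent monomial in `U` up to a unit of `A`. -/
def IsMonomialAt (ν : AddValuation F (WithTop ℚ)) (A : Subalgebra k F) (U f : F) : Prop :=
  ∃ (m : ℤ) (γ : F), IsUnitAt ν A γ ∧ f = U ^ m * γ

theorem IsMonomialAt.one : IsMonomialAt ν A U 1 := ⟨0, 1, .one, by simp⟩

theorem IsMonomialAt.mul (hU : U ≠ 0) (hf : IsMonomialAt ν A U f) (hg : IsMonomialAt ν A U g) :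
    IsMonomialAt ν A U (f * g) := by
  obtain ⟨m, γ, hγ, rfl⟩ := hf
  obtain ⟨n, η, hη, rfl⟩ := hg
  exact ⟨m + n, γ * η, hγ.mul hη, by rw [zpow_add₀ hU]; ring⟩

theorem IsMonomialAt.pow (hf : IsMonomialAt ν A U f) (n : ℕ) : IsMonomialAt ν A U (f ^ n) := by
  obtain ⟨m, γ, hγ, rfl⟩ := hf
  exact ⟨m * n, γ ^ n, hγ.pow n, by rw [zpow_mul, zpow_natCast, mul_pow]⟩

theorem IsMonomialAt.prod {ι : Type*} (hU : U ≠ 0) (s : Finset ι) {f : ι → F}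
    (hf : ∀ i ∈ s, IsMonomialAt ν A U (f i)) : IsMonomialAt ν A U (∏ i ∈ s, f i) := by
  classical
  induction s using Finset.induction_on with
  | empty => exact .one
  | insert a s ha ih =>
    rw [Finset.prod_insert ha]
    exact (hf a (by simp)).mul hU (ih fun i hi => hf i (by simp [hi]))

theorem IsMonomialAt.trans (hA' : Dominates ν A') (hAA' : A ≤ A') {n : ℕ} {γ : F}
    (hγ : IsUnitAt ν A' γ) (hU : U = U' ^ n * γ) (hf : IsMonomialAt ν A U f) :
    IsMonomialAt ν A' U' f := by
  obtain ⟨m, η, hη, rfl⟩ := hf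
  exact ⟨n * m, γ ^ m * η, (hγ.zpow hA' m).mul (hη.mono hAA'), by
    rw [hU, mul_zpow, zpow_mul, zpow_natCast, mul_assoc]⟩

end MonomialAt

/-! ### Iterating while `t` divides `p`. -/

section Tower

variable {k K E : Type*} [Field k] [CharZero k] [Field K] [Field E] [Algebra k K] [Algebra k E]
  [Algebra K E] [IsScalarTower k K E] {ν : AddValuation E (WithTop ℚ)}

-- Stage `j` has second parameter `W j` in both rings and uses divisibility of `p 1, …, p j` only.
-- Keeping `τ 0, …, τ j` monomial in `U` is what identifies the parameter produced by Euclid's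
-- algorithm with the prescribed `W (j + 1)`.
open scoped BigOperators in
theorem exists_toricPair_tower
    (hres : ∀ f : E, 0 ≤ ν f → ∃ c : k, 0 < ν (f - algebraMap k E c))
    {R : Subalgebra k K} {S : Subalgebra k E} {x : E} {t M : ℕ} (ht : 0 < t) {W P τ : ℕ → K}
    {N : ℕ → ℕ → ℕ} {p q : ℕ → ℕ} {lam : ℕ → k} {μ : ℚ} (hμ : 0 < μ)
    (hP : ∀ j, P j = ∏ i ∈ Finset.range j, τ i ^ N j i)
    (hτ : ∀ j < M, τ (j + 1) = W j * P j)
    (hW : ∀ j, j + 1 < M →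
      W (j + 1) = τ (j + 1) ^ q (j + 1) / P (j + 1) - algebraMap k K (lam (j + 1)))
    (hval : ∀ j < M, ν (algebraMap K E (W j)) =
      ((μ / (∏ i ∈ Finset.Icc 1 j, (q i : ℚ)) * (p (j + 1) / q (j + 1)) : ℚ) : WithTop ℚ))
    (hval0 : ∀ j, j + 1 < M → ν (algebraMap K E (τ (j + 1) ^ q (j + 1) / P (j + 1))) = 0)
    (hp : ∀ j, 0 < p (j + 1)) (hq : ∀ j, 0 < q (j + 1))
    (hpq : ∀ j, (p (j + 1)).Coprime (q (j + 1)))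
    (hdvd : ∀ j, j + 1 < M → t ∣ p (j + 1))
    (hRS : IsToricPair ν R S (τ 0) x t) (hR : IsRegularParameters R (τ 0) (W 0))
    (hS : IsRegularParameters S x (algebraMap K E (W 0))) (hx : ν x = μ) :
    ∀ j < M, ∃ R' S' U X, QuadraticSequence (ν.comap (algebraMap K E)) R R' ∧
      QuadraticSequence ν S S' ∧ IsToricPair ν R' S' U X t ∧
      IsRegularParameters R' U (W j) ∧ IsRegularParameters S' X (algebraMap K E (W j)) ∧
      ν X = ((μ / ∏ i ∈ Finset.Icc 1 j, (q i : ℚ) : ℚ) : WithTop ℚ) ∧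
      ∀ i ≤ j, IsMonomialAt (ν.comap (algebraMap K E)) R' U (τ i) := by
  intro j
  induction j with
  | zero =>
    intro hM
    refine ⟨R, S, τ 0, x, .refl, .refl, hRS, hR, hS, by simpa using hx, fun i hi => ?_⟩
    obtain rfl : i = 0 := by omega
    exact ⟨1, 1, .one, by simp⟩
  | succ j ih =>
    intro hM
    obtain ⟨R₁, S₁, U, X, hRR₁, hSS₁, hpair, hR₁, hS₁, hX, hmon⟩ := ih (by omega)
    obtain ⟨p', hp'⟩ := hdvd j hM
    have hp'0 : 0 < p' := Nat.pos_of_ne_zero (by rintro rfl; simpa [hp'] using (hp j).ne')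
    obtain ⟨hR₁d, hS₁d, -, Δ, hΔ, hUΔ⟩ := id hpair
    have hU0 := hR₁.left_ne_zero
    set Q : ℚ := ∏ i ∈ Finset.Icc 1 j, (q i : ℚ) with hQ
    have hQ0 : Q ≠ 0 := Finset.prod_ne_zero_iff.2 fun i hi => by
      obtain ⟨i, rfl⟩ := Nat.exists_eq_add_of_le' (Finset.mem_Icc.1 hi).1
      exact_mod_cast (hq i).ne'
    have hq0 : (q (j + 1) : ℚ) ≠ 0 := by exact_mod_cast (hq j).ne'
    have hpt : (p (j + 1) : ℚ) = t * p' := by exact_mod_cast hp'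
    have ht0 : (t : ℚ) ≠ 0 := by exact_mod_cast ht.ne'
    have hWv := hval j (by omega)
    rw [← hQ] at hWv
    have hUv : ν (algebraMap K E U) = ((t * (μ / Q) : ℚ) : WithTop ℚ) := by
      rw [hUΔ, ν.map_mul, hΔ.2, add_zero, val_pow_eq hX]
    have hpos : 0 < ν (algebraMap K E (W (j + 1))) := by
      rw [hval _ hM]
      have h1 : 0 < ∏ i ∈ Finset.Icc 1 (j + 1), (q i : ℚ) := Finset.prod_pos fun i hi => by
        obtain ⟨i, rfl⟩ := Nat.exists_eq_add_of_le' (Finset.mem_Icc.1 hi).1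
        exact_mod_cast hq i
      have h2 : (0 : ℚ) < p (j + 1 + 1) := by exact_mod_cast hp _
      have h3 : (0 : ℚ) < q (j + 1 + 1) := by exact_mod_cast hq _
      have : 0 < μ / (∏ i ∈ Finset.Icc 1 (j + 1), (q i : ℚ)) *
        (p (j + 1 + 1) / q (j + 1 + 1)) := by positivity
      exact_mod_cast this
    -- With `p (j + 1) = t * p'` the whole of `t` is the common factor `g`, so the relation `U = X ^
    -- t * unit` survives.
    obtain ⟨R', S', U', X', hRR', hSS', hpair', ⟨γ₁, hγ₁, hUe⟩, ⟨γ₂, hγ₂, hbe⟩, ⟨η, hη, hXe⟩,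
      hreg⟩ := (show IsToricPair ν R₁ S₁ U X (1 * t) by rwa [one_mul]).exists_transform hres hp'0
        one_pos ht (hq j) (Nat.coprime_one_left p')
        (by rw [mul_comm, ← hp']; exact hpq j) hR₁ hS₁ (by
          rw [val_div_eq (val_pow_eq hWv _) (val_pow_eq hX _), hpt]
          have : (q (j + 1) : ℚ) * (μ / Q * (t * p' / q (j + 1))) -
              ((p' * t : ℕ) : ℚ) * (μ / Q) = 0 := by
            push_cast
            field_simp
            ring
          exact WithTop.coe_eq_zero.2 this)
    have hR'd := hpair'.1
    have hU'0 : U' ≠ 0 := by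
      rintro rfl
      rw [zero_pow (Nat.mul_pos one_pos (hq j)).ne', zero_mul] at hUe
      exact hU0 hUe
    have hτ1 : IsMonomialAt (ν.comap (algebraMap K E)) R₁ U (P j) := by
      rw [hP]
      exact .prod hU0 _ fun i hi => (hmon i (Finset.mem_range.1 hi).le).pow _
    obtain ⟨m₀, γ₀, hγ₀, hPj⟩ := id hτ1
    have hτmon : ∀ i ≤ j + 1, IsMonomialAt (ν.comap (algebraMap K E)) R' U' (τ i) := by
      intro i hi
      rcases Nat.lt_or_ge i (j + 1) with hlt | hge
      · exact (hmon i (by omega)).trans hR'd hRR'.le hγ₁ hUe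
      · obtain rfl : i = j + 1 := by omega
        rw [hτ j (by omega)]
        exact .mul hU'0 ⟨p', γ₂, hγ₂, by rw [zpow_natCast, hbe]⟩
          (hτ1.trans hR'd hRR'.le hγ₁ hUe)
    have hPmon : ∃ (m : ℤ) (γ : K), IsUnitAt (ν.comap (algebraMap K E)) R₁ γ ∧
        τ (j + 1) ^ q (j + 1) / P (j + 1) = W j ^ q (j + 1) * (U ^ m * γ) := by
      obtain ⟨m', γ', hγ', hP'⟩ : IsMonomialAt (ν.comap (algebraMap K E)) R₁ U (P (j + 1)) := by
        rw [hP]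
        exact .prod hU0 _ fun i hi =>
          (hmon i (Nat.lt_succ_iff.1 (Finset.mem_range.1 hi))).pow _
      have hγ'0 := hγ'.ne_zero
      refine ⟨m₀ * q (j + 1) - m', γ₀ ^ q (j + 1) / γ', (hγ₀.pow _).div hγ' hR₁d, ?_⟩
      rw [hτ j (by omega), hPj, hP', zpow_sub₀ hU0, zpow_mul, zpow_natCast, mul_pow, mul_pow]
      field_simp
    obtain ⟨m, γ, hγ, hratio⟩ := hPmon
    -- The exponent of `U` is forced because the ratio has value zero.
    have hm : m = -(p' : ℤ) := by
      have h0 := hval0 j hM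
      have hγv : ν (algebraMap K E γ) = 0 := hγ.2
      rw [hratio, (algebraMap K E).map_mul, (algebraMap K E).map_mul, map_pow, map_zpow₀, ν.map_mul, ν.map_mul, hγv, add_zero,
        ← ν.map_mul, val_mul_eq (val_pow_eq hWv _) (val_zpow_eq hUv _), hpt] at h0
      have h1 : (q (j + 1) : ℚ) * (μ / Q * (t * p' / q (j + 1))) + m * (t * (μ / Q)) = 0 := by
        exact WithTop.coe_eq_zero.1 h0
      have h2 : (t * (μ / Q)) * ((m : ℚ) + p') = 0 := by
        rw [← h1]
        field_simp
        ring
      have h3 : (m : ℚ) + p' = 0 :=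
        (mul_eq_zero.1 h2).resolve_left (mul_ne_zero ht0 (div_ne_zero hμ.ne' hQ0))
      have h4 : m + (p' : ℤ) = 0 := by exact_mod_cast h3
      omega
    have hratio' : τ (j + 1) ^ q (j + 1) / P (j + 1) = W j ^ (1 * q (j + 1)) / U ^ p' * γ := by
      rw [hratio, hm, zpow_neg, zpow_natCast, one_mul]
      ring
    have hWe := hW j hM
    rw [hratio'] at hWe
    obtain ⟨hreg1, hreg2⟩ := hreg γ (lam (j + 1)) hγ (by rw [← hWe]; exact hpos)
    rw [← hWe] at hreg1 hreg2
    refine ⟨R', S', U', X', hRR₁.trans hRR', hSS₁.trans hSS', hpair', hreg1, hreg2, ?_, hτmon⟩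
    obtain ⟨ξ, hξ⟩ := exists_val_eq ν hreg2.left_ne_zero
    have h1 := hX
    rw [hXe, ν.map_mul, hη.2, add_zero, val_pow_eq hξ] at h1
    have h2 : (q (j + 1) : ℚ) * ξ = μ / Q := WithTop.coe_eq_coe.1 h1
    rw [hξ, Finset.prod_Icc_succ_top (by omega), ← hQ, ← div_div, ← h2]
    congr 1
    field_simp

end Tower

/-! ### Divisibility of exponents and descent to `K`. -/

section Descent

variable {k K L : Type*} [Field k] [Field K] [Field L] [Algebra k K] [Algebra k L]
  {w : AddValuation L (WithTop ℚ)} {T : ℕ → L} {p q : ℕ → ℕ} {μ : ℚ} {β : ℕ → ℚ} {n : ℕ → ℕ → ℕ}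
  {lam : ℕ → k} {t : ℕ}

open scoped BigOperators in
/-- The numerical data which exhibit `T` as a sequence of jumping polynomials. -/
structure IsJumpingData (w : AddValuation L (WithTop ℚ)) (T : ℕ → L) (p q : ℕ → ℕ) (μ : ℚ)
    (β : ℕ → ℚ) (n : ℕ → ℕ → ℕ) (lam : ℕ → k) : Prop where
  mu_pos : 0 < μ
  val : ∀ i, w (T i) = ((μ * β i : ℚ) : WithTop ℚ)
  beta_zero : β 0 = 1
  beta_one : β 1 = (p 1 : ℚ) / (q 1 : ℚ)
  p_pos : ∀ i, 1 ≤ i → 0 < p i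
  q_pos : ∀ i, 1 ≤ i → 0 < q i
  coprime : ∀ i, 1 ≤ i → Nat.Coprime (p i) (q i)
  n_lt : ∀ i, 1 ≤ i → ∀ j, 1 ≤ j → j < i → n i j < q j
  relation : ∀ i, 1 ≤ i → (q i : ℚ) * β i = ∑ j ∈ Finset.range i, (n i j : ℚ) * β j
  residue : ∀ i, 1 ≤ i →
    0 < w (T i ^ q i / (∏ j ∈ Finset.range i, T j ^ n i j) - algebraMap k L (lam i))
  succ_eq : ∀ i, 1 ≤ i →
    T (i + 1) = T i ^ q i - algebraMap k L (lam i) * ∏ j ∈ Finset.range i, T j ^ n i j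
  beta_succ : ∀ i, 1 ≤ i → β (i + 1) = (q i : ℚ) * β i
    + 1 / (∏ j ∈ Finset.Icc 1 i, (q j : ℚ)) * ((p (i + 1) : ℚ) / (q (i + 1) : ℚ))

theorem isJumpingSequence_iff {A : Subalgebra k L} :
    IsJumpingSequence w A T p q ↔ (∀ i, T i ∈ A) ∧
      ∃ (μ : ℚ) (β : ℕ → ℚ) (n : ℕ → ℕ → ℕ) (lam : ℕ → k), IsJumpingData w T p q μ β n lam := by
  refine and_congr_right fun _ => exists_congr fun μ => exists_congr fun β => exists_congr fun n =>
    exists_congr fun lam => ⟨fun ⟨h1, h2, h3, h4, h⟩ => ⟨h1, h2, h3, h4, fun i hi => (h i hi).1,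
      fun i hi => (h i hi).2.1, fun i hi => (h i hi).2.2.1, fun i hi => (h i hi).2.2.2.1,
      fun i hi => (h i hi).2.2.2.2.1, fun i hi => (h i hi).2.2.2.2.2.1,
      fun i hi => (h i hi).2.2.2.2.2.2.1, fun i hi => (h i hi).2.2.2.2.2.2.2⟩,
    fun h => ⟨h.mu_pos, h.val, h.beta_zero, h.beta_one, fun i hi => ⟨h.p_pos i hi, h.q_pos i hi,
      h.coprime i hi, h.n_lt i hi, h.relation i hi, h.residue i hi, h.succ_eq i hi,
      h.beta_succ i hi⟩⟩⟩

namespace IsJumpingData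

theorem q_ne_zero (D : IsJumpingData w T p q μ β n lam) {i : ℕ} (hi : 1 ≤ i) : (q i : ℚ) ≠ 0 := by
  exact_mod_cast (D.q_pos i hi).ne'

theorem prod_q_ne_zero (D : IsJumpingData w T p q μ β n lam) (i : ℕ) :
    ∏ j ∈ Finset.Icc 1 i, (q j : ℚ) ≠ 0 :=
  Finset.prod_ne_zero_iff.2 fun _ hj => D.q_ne_zero (Finset.mem_Icc.1 hj).1

/-- With `Q_i = q_1⋯q_i`, the recursion reads `Q_{i+1} β_{i+1} = q_{i+1} q_i (Q_i β_i) + p_{i+1}`,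
which stays in `tℤ`. -/
theorem prod_mul_beta_mem (D : IsJumpingData w T p q μ β n lam) {i : ℕ} (hi : 1 ≤ i)
    (ht : ∀ j, 1 ≤ j → j ≤ i → t ∣ p j) :
    (∏ j ∈ Finset.Icc 1 i, (q j : ℚ)) * β i ∈ AddSubgroup.zmultiples (t : ℚ) := by
  have hmem : ∀ j, 1 ≤ j → j ≤ i → (p j : ℚ) ∈ AddSubgroup.zmultiples (t : ℚ) := fun j h1 h2 => by
    obtain ⟨c, hc⟩ := ht j h1 h2
    exact AddSubgroup.mem_zmultiples_iff.2 ⟨c, by rw [hc]; push_cast; simp [mul_comm]⟩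
  induction i, hi using Nat.le_induction with
  | base =>
    rw [Finset.Icc_self, Finset.prod_singleton, D.beta_one,
      mul_div_cancel₀ _ (D.q_ne_zero le_rfl)]
    exact hmem 1 le_rfl le_rfl
  | succ i hi ih =>
    have h1 := ih (fun j hj hj' => ht j hj (by omega)) (fun j hj hj' => hmem j hj (by omega))
    have h2 := D.prod_q_ne_zero i
    have h3 := D.q_ne_zero (i := i + 1) (by omega)
    have : (∏ j ∈ Finset.Icc 1 (i + 1), (q j : ℚ)) * β (i + 1) =
        (q (i + 1) * q i) • ((∏ j ∈ Finset.Icc 1 i, (q j : ℚ)) * β i) + p (i + 1) := by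
      rw [Finset.prod_Icc_succ_top (by omega), D.beta_succ i hi, nsmul_eq_mul]
      push_cast
      field_simp
    rw [this]
    exact add_mem (nsmul_mem h1 _) (hmem _ (by omega) le_rfl)

theorem prod_mul_beta_mem_of_le (D : IsJumpingData w T p q μ β n lam) {i j : ℕ} (hj : 1 ≤ j)
    (hji : j ≤ i) (ht : ∀ l, 1 ≤ l → l ≤ j → t ∣ p l) :
    (∏ l ∈ Finset.Icc 1 i, (q l : ℚ)) * β j ∈ AddSubgroup.zmultiples (t : ℚ) := by
  induction i, hji using Nat.le_induction with
  | base => exact D.prod_mul_beta_mem hj ht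
  | succ i hi ih =>
    rw [Finset.prod_Icc_succ_top (by omega), mul_comm _ (q (i + 1) : ℚ), mul_assoc, ← nsmul_eq_mul]
    exact nsmul_mem ih _

/-- Multiply the relation for `q_i β_i` by `Q = q_1⋯q_i`: all terms with `β_j`, `j ≥ 1`, lie in
`tℤ`, hence so does `Q * n i 0`. Moreover `t` is prime to `Q`, since each `q_l` is prime to `p_l`, a
multiple of `t`. -/
theorem dvd_exponent (D : IsJumpingData w T p q μ β n lam) {i : ℕ} (hi : 1 ≤ i)
    (ht : ∀ j, 1 ≤ j → j ≤ i → t ∣ p j) : t ∣ n i 0 := by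
  set Q : ℚ := ∏ l ∈ Finset.Icc 1 i, (q l : ℚ) with hQ
  have hmem : Q * n i 0 ∈ AddSubgroup.zmultiples (t : ℚ) := by
    obtain ⟨i, rfl⟩ := Nat.exists_eq_add_of_le' hi
    have h1 := D.relation (i + 1) hi
    rw [Finset.sum_range_succ', D.beta_zero, mul_one] at h1
    have h2 : Q * n (i + 1) 0 = q (i + 1) • (Q * β (i + 1)) -
        ∑ j ∈ Finset.range i, n (i + 1) (j + 1) • (Q * β (j + 1)) := by
      simp only [nsmul_eq_mul]
      have h3 : ∑ j ∈ Finset.range i, (n (i + 1) (j + 1) : ℚ) * (Q * β (j + 1)) =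
          Q * ∑ j ∈ Finset.range i, (n (i + 1) (j + 1) : ℚ) * β (j + 1) := by
        rw [Finset.mul_sum]
        exact Finset.sum_congr rfl fun j _ => by ring
      rw [h3]
      linear_combination -Q * h1
    rw [h2]
    refine sub_mem (nsmul_mem (D.prod_mul_beta_mem hi ht) _) (sum_mem fun j hj => nsmul_mem
      (D.prod_mul_beta_mem_of_le (by omega) ?_ fun l h1 h2 => ht l h1 ?_) _)
    all_goals have := Finset.mem_range.1 hj; omega
  obtain ⟨z, hz⟩ := AddSubgroup.mem_zmultiples_iff.1 hmem
  have hz' : (t : ℤ) ∣ (((∏ l ∈ Finset.Icc 1 i, q l) * n i 0 : ℕ) : ℤ) := by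
    refine ⟨z, ?_⟩
    have : (((∏ l ∈ Finset.Icc 1 i, q l) * n i 0 : ℕ) : ℚ) = t * z := by
      push_cast
      rw [← hQ, ← hz, zsmul_eq_mul, mul_comm]
    exact_mod_cast this
  have hcop : Nat.Coprime t (∏ l ∈ Finset.Icc 1 i, q l) :=
    Nat.Coprime.prod_right fun l hl => Nat.Coprime.coprime_dvd_left
      (ht l (Finset.mem_Icc.1 hl).1 (Finset.mem_Icc.1 hl).2) (D.coprime l (Finset.mem_Icc.1 hl).1)
  exact hcop.dvd_of_dvd_mul_left (Int.natCast_dvd_natCast.1 hz')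

theorem val_prod (D : IsJumpingData w T p q μ β n lam) {i : ℕ} (hi : 1 ≤ i) :
    w (∏ j ∈ Finset.range i, T j ^ n i j) = ((μ * (q i * β i) : ℚ) : WithTop ℚ) := by
  rw [val_prod_eq _ fun j _ => val_pow_eq (D.val j) (n i j), D.relation i hi, Finset.mul_sum]
  congr 1
  exact Finset.sum_congr rfl fun j _ => by ring

theorem ne_zero (D : IsJumpingData w T p q μ β n lam) (i : ℕ) : T i ≠ 0 :=
  ne_zero_of_val_eq (D.val i)

theorem val_ratio (D : IsJumpingData w T p q μ β n lam) {i : ℕ} (hi : 1 ≤ i) :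
    w (T i ^ q i / ∏ j ∈ Finset.range i, T j ^ n i j) = 0 := by
  rw [val_div_eq (val_pow_eq (D.val i) _) (D.val_prod hi)]
  exact WithTop.coe_eq_zero.2 (by ring)

end IsJumpingData

/-- The exponents obtained from `n` if the first element is replaced by its `t`-th power. -/
def rescale (t : ℕ) (n : ℕ → ℕ → ℕ) (i j : ℕ) : ℕ := if j = 0 then n i 0 / t else n i j

theorem map_prod_rescale (φ : K →+* L) {τ : ℕ → K} {i : ℕ} (h0 : φ (τ 0) = T 0 ^ t)
    (hj : ∀ j, 1 ≤ j → j < i → φ (τ j) = T j) (ht : t ∣ n i 0) :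
    φ (∏ j ∈ Finset.range i, τ j ^ rescale t n i j) = ∏ j ∈ Finset.range i, T j ^ n i j := by
  rw [map_prod]
  refine Finset.prod_congr rfl fun j hji => ?_
  rw [map_pow, rescale]
  split_ifs with h
  · subst h
    rw [h0, ← pow_mul, Nat.mul_div_cancel' ht]
  · rw [hj j (by omega) (Finset.mem_range.1 hji)]

theorem IsJumpingData.exists_descent (D : IsJumpingData w T p q μ β n lam) (φ : K →+* L)
    (hφ : ∀ c : k, φ (algebraMap k K c) = algebraMap k L c) {R : Subalgebra k K} {u v : K}
    (hu : u ∈ R) (hv : v ∈ R) (h0 : φ u = T 0 ^ t) (h1 : φ v = T 1) :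
    ∃ τ : ℕ → K, τ 0 = u ∧
      ∀ i, 1 ≤ i → (∀ j, 1 ≤ j → j < i → t ∣ p j) → τ i ∈ R ∧ φ (τ i) = T i := by
  classical
  -- A preimage in `R` is chosen wherever one exists; the value 0 elsewhere is a dummy, reached only
  -- after divisibility has failed.
  let τ : ℕ → K := fun i => if i = 0 then u else
    if h : ∃ r ∈ R, φ r = T i then h.choose else 0
  have hτ0 : τ 0 = u := if_pos rfl
  have hτ : ∀ i, 1 ≤ i → (∃ r ∈ R, φ r = T i) → τ i ∈ R ∧ φ (τ i) = T i := fun i hi h => by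
    have : τ i = h.choose := by
      change (if i = 0 then u else if h : ∃ r ∈ R, φ r = T i then h.choose else 0) = _
      rw [if_neg (by omega), dif_pos h]
    rw [this]
    exact h.choose_spec
  refine ⟨τ, hτ0, fun i => ?_⟩
  induction i using Nat.strong_induction_on with
  | _ i ih =>
    intro hi ht
    refine hτ i hi ?_
    obtain ⟨i, rfl⟩ := Nat.exists_eq_add_of_le' hi
    rcases Nat.eq_zero_or_pos i with rfl | hpos
    · exact ⟨v, hv, h1⟩
    have ih' : ∀ j, 1 ≤ j → j ≤ i → τ j ∈ R ∧ φ (τ j) = T j := fun j hj hji =>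
      ih j (by omega) hj fun l hl hl' => ht l hl (by omega)
    refine ⟨τ i ^ q i - algebraMap k K (lam i) *
      ∏ j ∈ Finset.range i, τ j ^ rescale t n i j, ?_, ?_⟩
    · refine sub_mem (pow_mem (ih' i hpos le_rfl).1 _) (mul_mem (R.algebraMap_mem _)
        (prod_mem fun j hj => pow_mem ?_ _))
      rcases Nat.eq_zero_or_pos j with rfl | hj0
      · rwa [hτ0]
      · exact (ih' j hj0 (Finset.mem_range.1 hj).le).1
    · rw [map_sub, map_mul, map_pow, hφ, (ih' i hpos le_rfl).2,
        map_prod_rescale φ (by rw [hτ0, h0]) (fun j hj hji => (ih' j hj hji.le).2)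
          (D.dvd_exponent hpos fun l hl hl' => ht l hl (by omega)), D.succ_eq i hpos]

/-- The first element becomes `T 0 ^ t`, of value `t * μ`, so normalized values of the others are
divided by `t`, and so are the `p i`. The `q i` and the residues `lam i` are unchanged. -/
theorem IsJumpingData.descend (D : IsJumpingData w T p q μ β n lam) (φ : K →+* L)
    (hφ : ∀ c : k, φ (algebraMap k K c) = algebraMap k L c) {τ : ℕ → K} (ht0 : 0 < t)
    (ht : ∀ i, 1 ≤ i → t ∣ p i) (h0 : φ (τ 0) = T 0 ^ t) (h1 : ∀ i, 1 ≤ i → φ (τ i) = T i) :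
    IsJumpingData (w.comap φ) τ (fun i => p i / t) q (t * μ)
      (fun i => if i = 0 then 1 else β i / t) (rescale t n) lam := by
  have ht' : (t : ℚ) ≠ 0 := by exact_mod_cast ht0.ne'
  have hn : ∀ i, 1 ≤ i → t ∣ n i 0 := fun i hi => D.dvd_exponent hi fun j hj _ => ht j hj
  have hprod : ∀ i, 1 ≤ i → φ (∏ j ∈ Finset.range i, τ j ^ rescale t n i j) =
      ∏ j ∈ Finset.range i, T j ^ n i j := fun i hi =>
    map_prod_rescale φ h0 (fun j hj _ => h1 j hj) (hn i hi)
  have hp : ∀ i, 1 ≤ i → ((p i / t : ℕ) : ℚ) = p i / t := fun i hi =>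
    Nat.cast_div (ht i hi) ht'
  refine ⟨by have := D.mu_pos; positivity, fun i => ?_, if_pos rfl, ?_, fun i hi => ?_, D.q_pos,
    fun i hi => ?_, fun i hi j hj hji => ?_, fun i hi => ?_, fun i hi => ?_, fun i hi => ?_,
    fun i hi => ?_⟩
  · change w (φ (τ i)) = _
    rcases Nat.eq_zero_or_pos i with rfl | hi
    · rw [h0, val_pow_eq (D.val 0), D.beta_zero, if_pos rfl]
      congr 1
      ring
    · rw [h1 i hi, D.val, if_neg (by omega)]
      congr 1
      field_simp
  · rw [if_neg one_ne_zero, D.beta_one, hp 1 le_rfl]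
    ring
  · exact Nat.div_pos (Nat.le_of_dvd (D.p_pos i hi) (ht i hi)) ht0
  · exact Nat.Coprime.coprime_dvd_left (Nat.div_dvd_of_dvd (ht i hi)) (D.coprime i hi)
  · rw [rescale, if_neg (by omega)]
    exact D.n_lt i hi j hj hji
  · have h2 := D.relation i hi
    obtain ⟨i, rfl⟩ := Nat.exists_eq_add_of_le' hi
    rw [Finset.sum_range_succ', D.beta_zero] at h2
    rw [Finset.sum_range_succ', if_neg (by omega), if_pos rfl, mul_div_assoc', h2, add_div,
      Finset.sum_div]
    congr 1
    · refine Finset.sum_congr rfl fun j _ => ?_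
      rw [rescale, if_neg (by omega), if_neg (by omega), mul_div_assoc]
    · rw [rescale, if_pos rfl, Nat.cast_div (hn _ hi) ht', mul_one, mul_one]
  · change 0 < w (φ _)
    rw [map_sub, map_div₀, map_pow, hφ, hprod i hi, h1 i hi]
    exact D.residue i hi
  · apply φ.injective
    rw [map_sub, map_mul, map_pow, hφ, hprod i hi, h1 i hi, h1 _ (by omega)]
    exact D.succ_eq i hi
  · simp only [Nat.add_eq_zero_iff, one_ne_zero, and_false, if_false]
    rw [if_neg (by omega), D.beta_succ i hi, hp _ (by omega)]
    ring

end Descent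

end JumpingPoly

/-! ### Assembly of the two alternatives. -/

theorem lemma8p3
    {k K Kstar L : Type*} [Field k] [IsAlgClosed k] [CharZero k]
    [Field K] [Field Kstar] [Field L]
    [Algebra k K] [Algebra k Kstar] [Algebra k L]
    [Algebra K Kstar] [Algebra Kstar L]
    [IsScalarTower k K Kstar] [IsScalarTower k Kstar L]
    -- `Kstar / K` is a finite extension of function fields of transcendence degree two
    (hKfg : (⊤ : IntermediateField k K).FG) (hKtr : Algebra.trdeg k K = 2)
    [FiniteDimensional K Kstar]
    -- a valuation over `k` of `Kstar`, value group inside `ℚ`, residue field `k`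
    (ν : AddValuation Kstar (WithTop ℚ))
    (hνk : ∀ c : k, c ≠ 0 → ν (algebraMap k Kstar c) = 0)
    (hνres : ∀ f : Kstar, 0 ≤ ν f → ∃ c : k, 0 < ν (f - algebraMap k Kstar c))
    -- algebraic regular local rings with quotient fields `K` and `Kstar`
    (R : Subalgebra k K) (S : Subalgebra k Kstar)
    [Algebra.EssFiniteType k R] [Algebra.EssFiniteType k S]
    [IsFractionRing R K] [IsFractionRing S Kstar]
    (hRS : JumpingPoly.LocalDominates R S) (hSν : JumpingPoly.Dominates ν S)
    -- regular parameters with `u = x ^ t * δ` and `v = y`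
    (u v : K) (x y : Kstar)
    (huv : JumpingPoly.IsRegularParameters R u v)
    (hxy : JumpingPoly.IsRegularParameters S x y)
    (t : ℕ) (ht : 0 < t) (δ : (↥S)ˣ)
    (hu : algebraMap K Kstar u = x ^ t * ((δ : S) : Kstar))
    (hv : algebraMap K Kstar v = y)
    -- a root `ε = δ ^ (1 / t)` in an extension field `L`, and an extension `w` of `ν` to `L`
    (ε : L) (hε : ε ^ t = algebraMap Kstar L ((δ : S) : Kstar))
    (w : AddValuation L (WithTop ℚ)) (hw : w.comap (algebraMap Kstar L) = ν)
    -- the jumping polynomials in the localization of `S[ε]` at the centre of `w`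
    (T : ℕ → L) (p q : ℕ → ℕ)
    (hT0 : T 0 = algebraMap Kstar L x * ε) (hT1 : T 1 = algebraMap Kstar L y)
    (hT : JumpingPoly.IsJumpingSequence w
      (JumpingPoly.localizeAtCentre w (JumpingPoly.adjoinElement S ε)) T p q) :
    (∃ T' : ℕ → K, T' 0 = u ∧
      (∀ i, 0 < i → algebraMap Kstar L (algebraMap K Kstar (T' i)) = T i) ∧
      ∃ p' q' : ℕ → ℕ,
        JumpingPoly.IsJumpingSequence (ν.comap (algebraMap K Kstar)) R T' p' q') ∨
    (∃ M g : ℕ, IsLeast {i : ℕ | 0 < i ∧ ¬ t ∣ p i} M ∧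
      g = Nat.gcd t (p M) ∧ 0 < g ∧ g < t ∧
      ∃ (R' : Subalgebra k K) (S' : Subalgebra k Kstar),
        JumpingPoly.QuadraticSequence (ν.comap (algebraMap K Kstar)) R R' ∧
        JumpingPoly.QuadraticSequence ν S S' ∧
        JumpingPoly.LocalDominates R' S' ∧
        ∃ (U V : K) (X Y : Kstar) (Δ : (↥S')ˣ),
          JumpingPoly.IsRegularParameters R' U V ∧
          JumpingPoly.IsRegularParameters S' X Y ∧
          algebraMap K Kstar U = X ^ g * ((Δ : S') : Kstar) ∧
          algebraMap K Kstar V = Y) := by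
  subst hw
  rw [JumpingPoly.isJumpingSequence_iff] at hT
  obtain ⟨-, μ, β, n, lam, D⟩ := hT
  set φ : K →+* L := (algebraMap Kstar L).comp (algebraMap K Kstar) with hφ
  have hφk : ∀ c : k, φ (algebraMap k K c) = algebraMap k L c := fun c => by
    rw [hφ, RingHom.comp_apply, ← IsScalarTower.algebraMap_apply k K Kstar,
      ← IsScalarTower.algebraMap_apply k Kstar L]
  have hφv : ∀ f : K, (w.comap (algebraMap Kstar L)) (algebraMap K Kstar f) = w (φ f) :=
    fun f => rfl
  have hδ : JumpingPoly.IsUnitAt (w.comap (algebraMap Kstar L)) S ((δ : S) : Kstar) := by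
    refine ⟨(δ : S).2, ?_⟩
    have h := hSν.pos_iff_not_isUnit (δ : S)
    exact le_antisymm (not_lt.1 fun hlt => h.1 hlt δ.isUnit) (hSν _ (δ : S).2).1
  have hu0 : φ u = T 0 ^ t := by
    rw [hT0, mul_pow, hε, hφ, RingHom.comp_apply, hu, map_mul, map_pow]
  have hv1 : φ v = T 1 := by rw [hT1, hφ, RingHom.comp_apply, hv]
  -- `ε` has value zero because its `t`-th power is a unit, so `x` has the same value as `T 0`.
  have hxv : (w.comap (algebraMap Kstar L)) x = (μ : WithTop ℚ) := by
    have hε0 : ε ≠ 0 := fun h0 => D.ne_zero 0 (by rw [hT0, h0, mul_zero])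
    obtain ⟨r, hr⟩ := JumpingPoly.exists_val_eq w hε0
    have h1 : w (ε ^ t) = 0 := by rw [hε]; exact hδ.2
    rw [JumpingPoly.val_pow_eq hr, WithTop.coe_eq_zero] at h1
    have hr0 : r = 0 := (mul_eq_zero.1 h1).resolve_left (by exact_mod_cast ht.ne')
    have h2 := D.val 0
    rw [hT0, w.map_mul, hr, hr0, D.beta_zero, mul_one, WithTop.coe_zero, add_zero] at h2
    exact h2
  obtain ⟨τ, hτ0, hτ⟩ := D.exists_descent φ hφk huv.left_mem huv.right_mem hu0 hv1
  have hτ0' : φ (τ 0) = T 0 ^ t := by rw [hτ0, hu0]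
  by_cases hall : ∀ i, 1 ≤ i → t ∣ p i
  · left
    have hτ' := fun i hi => hτ i hi fun j hj _ => hall j hj
    refine ⟨τ, hτ0, fun i hi => (hτ' i hi).2, _, _, JumpingPoly.isJumpingSequence_iff.2
      ⟨fun i => ?_, _, _, _, _, D.descend φ hφk ht hall hτ0' fun i hi => (hτ' i hi).2⟩⟩
    rcases Nat.eq_zero_or_pos i with rfl | hi
    · rw [hτ0]; exact huv.left_mem
    · exact (hτ' i hi).1
  right
  push Not at hall
  obtain ⟨M, ⟨hM1, hMp⟩, hMmin⟩ : ∃ M, (1 ≤ M ∧ ¬ t ∣ p M) ∧ ∀ j, 1 ≤ j → j < M → t ∣ p j :=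
    ⟨Nat.find hall, Nat.find_spec hall, fun j hj hjM => by
      by_contra hc
      exact Nat.find_min hall hjM ⟨hj, hc⟩⟩
  have hg0 : 0 < Nat.gcd t (p M) := Nat.gcd_pos_of_pos_left _ ht
  have hgt : Nat.gcd t (p M) < t := by
    refine lt_of_le_of_ne (Nat.gcd_le_left _ ht) fun h => hMp ?_
    rw [← h]
    exact Nat.gcd_dvd_right _ _
  refine ⟨M, _, ⟨⟨hM1, hMp⟩, fun i hi => ?_⟩, rfl, hg0, hgt, ?_⟩
  · by_contra hc
    exact hi.2 (hMmin i hi.1 (not_le.1 hc))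
  have hτM : ∀ i, 1 ≤ i → i ≤ M → φ (τ i) = T i := fun i hi hiM =>
    (hτ i hi fun j hj hji => hMmin j hj (by omega)).2
  set P : ℕ → K := fun j => ∏ i ∈ Finset.range j, τ i ^ JumpingPoly.rescale t n j i with hP
  have hPφ : ∀ j, 1 ≤ j → j < M → φ (P j) = ∏ i ∈ Finset.range j, T i ^ n j i := fun j hj hjM =>
    JumpingPoly.map_prod_rescale φ hτ0' (fun i hi hij => hτM i hi (by omega))
      (D.dvd_exponent hj fun l hl hlj => hMmin l hl (by omega))
  have hP0 : ∀ j < M, P j ≠ 0 := fun j hjM => by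
    rcases Nat.eq_zero_or_pos j with rfl | hj
    · simp [hP]
    · intro h0
      have := hPφ j hj hjM
      rw [h0, map_zero] at this
      exact JumpingPoly.ne_zero_of_val_eq (D.val_prod hj) this.symm
  -- The shift matters: `P 0` is an empty product, so `W 0 = v`.
  set W : ℕ → K := fun j => τ (j + 1) / P j with hW
  have hW0 : W 0 = v := φ.injective (by
    simp only [hW, hP, Finset.range_zero, Finset.prod_empty, div_one]
    rw [hτM 1 le_rfl hM1, hv1])
  have hWval : ∀ j < M, (w.comap (algebraMap Kstar L)) (algebraMap K Kstar (W j)) =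
      ((μ / (∏ i ∈ Finset.Icc 1 j, (q i : ℚ)) * (p (j + 1) / q (j + 1)) : ℚ) : WithTop ℚ) := by
    intro j hjM
    rw [hφv, map_div₀, hτM (j + 1) (by omega) hjM]
    rcases Nat.eq_zero_or_pos j with rfl | hj
    · simp only [hP, Finset.range_zero, Finset.prod_empty, map_one, div_one, zero_add]
      rw [D.val, D.beta_one]
      simp
    · rw [hPφ j hj hjM, JumpingPoly.val_div_eq (D.val _) (D.val_prod hj), D.beta_succ j hj]
      congr 1
      ring
  have hpair : JumpingPoly.IsToricPair (w.comap (algebraMap Kstar L)) R S (τ 0) x t :=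
    ⟨hSν.comap hRS, hSν, fun a ha => (hRS a ha).1, _, hδ, by rw [hτ0, hu]⟩
  -- Stage `M - 1` is the last one that needs only divisibility below `M`; the ratio formed next
  -- involves `p M`.
  obtain ⟨R₁, S₁, U, X, hRR₁, hSS₁, hpair₁, hR₁, hS₁, hX, -⟩ :=
    JumpingPoly.exists_toricPair_tower (W := W) (lam := lam) (μ := μ) (q := q) (p := p)
      hνres ht D.mu_pos
      (fun j => rfl) (fun j hj => (div_mul_cancel₀ (τ (j + 1)) (hP0 j hj)).symm)
      (fun j hj => by
        have h0 := hP0 (j + 1) hj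
        have : τ (j + 1 + 1) = τ (j + 1) ^ q (j + 1) - algebraMap k K (lam (j + 1)) * P (j + 1) :=
          φ.injective (by
            rw [map_sub, map_mul, map_pow, hφk, hPφ _ (by omega) hj, hτM _ (by omega) hj,
              hτM _ (by omega) hj.le]
            exact D.succ_eq _ (by omega))
        change τ (j + 1 + 1) / P (j + 1) = _
        rw [this, sub_div, mul_div_cancel_right₀ _ h0])
      hWval
      (fun j hj => by
        rw [hφv, map_div₀, map_pow, hPφ _ (by omega) hj, hτM _ (by omega) hj.le]
        exact D.val_ratio (by omega))
      (fun j => D.p_pos _ (by omega)) (fun j => D.q_pos _ (by omega))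
      (fun j => D.coprime _ (by omega)) (fun j hj => hMmin _ (by omega) hj) hpair
      (by rw [hτ0, hW0]; exact huv) (by rw [hW0, hv]; exact hxy) hxv (M - 1) (by omega)
  obtain ⟨t', p', hcop, ht', hp'⟩ := Nat.exists_coprime t (p M)
  set g := Nat.gcd t (p M) with hg
  have hWM := hWval (M - 1) (by omega)
  rw [Nat.sub_add_cancel hM1] at hWM
  have hpM := D.p_pos M hM1
  have hqM := D.q_ne_zero hM1
  obtain ⟨R₂, S₂, U₂, X₂, hRR₂, hSS₂, hpair₂, -, -, -, hreg⟩ :=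
    (show JumpingPoly.IsToricPair (w.comap (algebraMap Kstar L)) R₁ S₁ U X (t' * g) by
      rwa [← ht']).exists_transform hνres (p := p') (q := q M)
      (Nat.pos_of_ne_zero (by rintro rfl; omega)) (Nat.pos_of_ne_zero (by rintro rfl; omega))
      hg0 (D.q_pos M hM1) hcop (by rw [← hp']; exact D.coprime M hM1) hR₁ hS₁ (by
        rw [JumpingPoly.val_div_eq (JumpingPoly.val_pow_eq hWM _) (JumpingPoly.val_pow_eq hX _),
          ← hp']
        refine WithTop.coe_eq_zero.2 ?_
        field_simp
        ring)
  obtain ⟨Δ₁, hΔ₁, hU⟩ := hpair₁.2.2.2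
  have hUv : (w.comap (algebraMap Kstar L)) (algebraMap K Kstar U) =
      ((t * (μ / ∏ i ∈ Finset.Icc 1 (M - 1), (q i : ℚ)) : ℚ) : WithTop ℚ) := by
    rw [hU, AddValuation.map_mul, hΔ₁.2, add_zero, JumpingPoly.val_pow_eq hX]
  have hratio : ((w.comap (algebraMap Kstar L)).comap (algebraMap K Kstar))
      (W (M - 1) ^ (t' * q M) / U ^ p') = 0 := by
    change (w.comap (algebraMap Kstar L)) (algebraMap K Kstar _) = 0
    have ht'' : (t : ℚ) = t' * g := by exact_mod_cast ht'
    have hp'' : (p M : ℚ) = p' * g := by exact_mod_cast hp'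
    rw [map_div₀, map_pow, map_pow,
      JumpingPoly.val_div_eq (JumpingPoly.val_pow_eq hWM _) (JumpingPoly.val_pow_eq hUv _)]
    refine WithTop.coe_eq_zero.2 ?_
    rw [ht'', hp'']
    push_cast
    field_simp
    ring
  -- Beyond `M` no jumping polynomial is followed in `R`: `V` is the ratio minus its residue `d`,
  -- with trivial unit factor.
  obtain ⟨d, hd⟩ := JumpingPoly.exists_residue_comap hνres _ hratio.ge
  obtain ⟨hR₂, hS₂⟩ := hreg 1 d .one (by rwa [mul_one])
  obtain ⟨Δ, hΔ, hU₂⟩ := hpair₂.2.2.2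
  have hΔinv := hΔ.inv hpair₂.2.1
  exact ⟨R₂, S₂, hRR₁.trans hRR₂, hSS₁.trans hSS₂, hpair₂.localDominates, U₂, _, X₂, _,
    ⟨⟨Δ, hΔ.1⟩, ⟨Δ⁻¹, hΔinv.1⟩, Subtype.ext (mul_inv_cancel₀ hΔ.ne_zero),
      Subtype.ext (inv_mul_cancel₀ hΔ.ne_zero)⟩, hR₂, hS₂, hU₂, rfl⟩
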